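/- Graphs are finite, undirected and loopless, but may have parallel edges. The line graph $L(H)$ of a graph $H$ is the simple graph whose vertices are the edges of $H$, two distinct edges (parallel edges included) being adjacent when they share an end; a graph is a line graph if it is (isomorphic to) $L(H)$ for some graph $H$. A set of vertices of $G$ is stable if its elements are pairwise non-adjacent; $\mathcal S(G)$ denotes the set of all stable sets of $G$. The stable set polytope $\mathrm{STAB}(G)\subseteq\mathbb R^{V(G)}$ is the convex hull of the characteristic vectors of the stable sets of $G$. An odd hole of $G$ is an induced circuit of $G$ with an odd number, at least $5$, of vertices. The graph $G$ is h-perfect if $$\mathrm{STAB}(G)=\Bigl\{x\in\mathbb R^{V(G)} : x\ge 0,\ \sum_{v\in K}x_v\le 1 \text{ for every clique } K \text{ of } G,\ \sum_{v\in V(C)}x_v\le \tfrac{|V(C)|-1}{2}\text{ for every odd hole } C \text{ of } G\Bigr\}.$$ For $c\in\mathbb Z_+^{V(G)}$ put $$\chi(G,c)=\min\Bigl\{\sum_{S\in\mathcal S(G)}y_S : y\in\mathbb Z_+^{\mathcal S(G)},\ \sum_{S\in\mathcal S(G):\,v\in S}y_S\ge c_v \text{ for all } v\in V(G)\Bigr\},$$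 and let $\chi_f(G,c)$ be the optimum value of the linear relaxation, obtained by replacing $\mathbb Z_+$ with $\mathbb Q_+$. **Theorem.** Every h-perfect line graph $G$ has the integer round-up property: for every $c\in\mathbb Z_+^{V(G)}$, $$\chi(G,c)=\lceil\chi_f(G,c)\rceil .$$ Moreover, $\mathrm{STAB}(G)$ has the integer decomposition property: for every integer $k\ge 1$, every integer vector of $k\cdot\mathrm{STAB}(G)$ is the sum of $k$ integer vectors of $\mathrm{STAB}(G)$. -/

import Mathlib

open scoped Pointwise

noncomputable section

/-- The line graph of a multigraph `H`: the simple graph whose vertices are the edges of `H`, two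
distinct edges (parallel ones included) being adjacent when they have a common end. -/
def Graph.lineGraph {α β : Type*} (H : Graph α β) : SimpleGraph H.edgeSet where
  Adj e f := e ≠ f ∧ ∃ x, H.Inc (e : β) x ∧ H.Inc (f : β) x
  symm := ⟨fun _ _ h => ⟨h.1.symm, h.2.imp fun _ hx => hx.symm⟩⟩
  loopless := ⟨fun _ h => h.1 rfl⟩

namespace SimpleGraph

/-- `G` is a line graph if it is, up to isomorphism, the line graph of a finite loopless graph,
possibly with parallel edges. (As `H` is finite, it is no restriction that its vertices and edges
come from types in the lowest universe.) -/
def IsLineGraph {V : Type*} (G : SimpleGraph V) : Prop :=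
  ∃ (α β : Type) (H : Graph α β), H.Loopless ∧ H.vertexSet.Finite ∧ H.edgeSet.Finite ∧
    Nonempty (G ≃g H.lineGraph)

/-- An odd hole of `G`, given by its vertex set: a set of vertices of odd size at least `5` which
induces a circuit. -/
def IsOddHole {V : Type*} (G : SimpleGraph V) (C : Finset V) : Prop :=
  Odd C.card ∧ 5 ≤ C.card ∧ Nonempty (G.induce (C : Set V) ≃g cycleGraph C.card)

/-- The stable set polytope of `G`: the convex hull in `ℝ^V` of the characteristic vectors of the
stable sets of `G`. -/
def stableSetPolytope {V : Type*} (G : SimpleGraph V) : Set (V → ℝ) :=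
  convexHull ℝ {x | ∃ S : Set V, G.IsIndepSet S ∧ x = S.indicator 1}

/-- `G` is h-perfect if its stable set polytope is described by the non-negativity, the clique and
the odd-hole inequalities. -/
def IsHPerfect {V : Type*} (G : SimpleGraph V) : Prop :=
  G.stableSetPolytope = {x | (∀ v, 0 ≤ x v) ∧
    (∀ K : Finset V, G.IsClique (K : Set V) → ∑ v ∈ K, x v ≤ 1) ∧
    (∀ C : Finset V, G.IsOddHole C → ∑ v ∈ C, x v ≤ ((C.card : ℝ) - 1) / 2)}

variable {V : Type*} [Fintype V]

open Classical in
/-- The family of all stable sets of `G`. -/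
def stableSets (G : SimpleGraph V) : Finset (Finset V) :=
  {S | G.IsIndepSet (S : Set V)}

open Classical in
/-- The values `∑ y_S` of the feasible points `y ∈ ℤ_+^{𝒮(G)}` of the covering program defining
the weighted chromatic number; `y S` is the multiplicity of the stable set `S`. -/
def coverSizes (G : SimpleGraph V) (c : V → ℕ) : Set ℕ :=
  {k | ∃ y : Finset V → ℕ, (∀ v, c v ≤ ∑ S ∈ G.stableSets with v ∈ S, y S) ∧
    k = ∑ S ∈ G.stableSets, y S}

open Classical in
/-- The values `∑ y_S` of the feasible points `y ∈ ℚ_+^{𝒮(G)}` of the linear relaxation. -/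
def fractionalCoverSizes (G : SimpleGraph V) (c : V → ℕ) : Set ℚ :=
  {q | ∃ y : Finset V → ℚ, (∀ S ∈ G.stableSets, 0 ≤ y S) ∧
    (∀ v, (c v : ℚ) ≤ ∑ S ∈ G.stableSets with v ∈ S, y S) ∧ q = ∑ S ∈ G.stableSets, y S}

theorem coverSizes_nonempty (G : SimpleGraph V) (c : V → ℕ) : (G.coverSizes c).Nonempty := by
  classical
  refine ⟨_, fun _ => ∑ v, c v, fun v => ?_, rfl⟩
  have hv : ({v} : Finset V) ∈ {S ∈ G.stableSets | v ∈ S} := by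
    simp [stableSets, IsIndepSet]
  exact (Finset.single_le_sum (f := c) (fun _ _ => Nat.zero_le _) (Finset.mem_univ v)).trans
    (Finset.single_le_sum (f := fun _ => ∑ v, c v) (fun _ _ => Nat.zero_le _) hv)

theorem cast_mem_fractionalCoverSizes {G : SimpleGraph V} {c : V → ℕ} {k : ℕ}
    (hk : k ∈ G.coverSizes c) : (k : ℚ) ∈ G.fractionalCoverSizes c := by
  classical
  obtain ⟨y, hy, rfl⟩ := hk
  refine ⟨fun S => y S, fun S _ => Nat.cast_nonneg _, fun v => ?_, by simp⟩
  rw [← Nat.cast_sum]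
  exact_mod_cast hy v

theorem nonneg_of_mem_fractionalCoverSizes {G : SimpleGraph V} {c : V → ℕ} {q : ℚ}
    (hq : q ∈ G.fractionalCoverSizes c) : 0 ≤ q := by
  obtain ⟨y, hy, -, rfl⟩ := hq
  exact Finset.sum_nonneg hy

/-- The weighted chromatic number `χ(G, c)`. -/
def weightedChromaticNumber (G : SimpleGraph V) (c : V → ℕ) : ℕ :=
  sInf (G.coverSizes c)

/-- The weighted fractional chromatic number `χ_f(G, c)`: the optimum value of the linear
relaxation. The set of values is non-empty and bounded below by `0`, as shown above, so this is a
genuine infimum (and, for a rational linear program, a minimum). -/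
def weightedFractionalChromaticNumber (G : SimpleGraph V) (c : V → ℕ) : ℝ :=
  sInf ((fun q : ℚ => (q : ℝ)) '' G.fractionalCoverSizes c)

/-- The integer round-up property for the chromatic number. -/
def IntegerRoundUpProperty (G : SimpleGraph V) : Prop :=
  ∀ c : V → ℕ, (G.weightedChromaticNumber c : ℤ) = ⌈G.weightedFractionalChromaticNumber c⌉

end SimpleGraph

/-- The integer decomposition property of `P ⊆ ℝ^V`: for every `k ≥ 1`, every integer vector of
`k • P` is the sum of `k` integer vectors of `P`. -/
def IntegerDecompositionProperty {V : Type*} (P : Set (V → ℝ)) : Prop :=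
  ∀ k : ℕ, 1 ≤ k → ∀ x : V → ℤ, (fun v => (x v : ℝ)) ∈ (k : ℝ) • P →
    ∃ z : Fin k → V → ℤ, (∀ i, (fun v => (z i v : ℝ)) ∈ P) ∧ x = ∑ i, z i

end

/-! Let `G` be the line graph of a loopless multigraph. Stable sets are matchings, so splitting a
weight `c` into `k` stable sets is an edge colouring with `k` colours of the multigraph with
multiplicities `c`. If `c` lies in `k • STAB`, then the edges at any vertex have total weight at
most `k`, and the edges inside any set of `2N + 1` vertices at most `kN`. The core is that these two
conditions suffice (`exists_edgeColoring`) when the underlying simple graph is not `Obstructed`,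
which h-perfection guarantees (`not_obstructed`).

An obstruction yields the point `(M₁ + M₂ + M₃ + ur) / 3`. It satisfies all clique and odd-hole
inequalities but has weight above `(|X| - 1) / 2` inside the odd set `X`. An odd circuit with an ear
of odd length, chords included, is of this kind (`obstructed_of_ear`).

The colouring is by induction on the total weight. Let all copies but one copy of `uv` be coloured.
A Kempe change either frees a colour at both ends, or the two-coloured chain closes with `uv` to an
odd circuit (`Critical`), around which the uncoloured edge can be rotated. The odd-set condition on
this circuit gives a third colour that leaves two of its vertices unmatched inside it. Two Kempe
changes with this colour free it at both ends of the uncoloured edge. They could fail only if a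
chain that has left the circuit came back to it, and the first return would be an odd ear, hence an
obstruction.

For the round-up property let `k = ⌈χ_f⌉`. By weak duality `c / k` satisfies the inequalities of the
h-perfect description, so it lies in `STAB`, and the decomposition of `c` into `k` stable sets is
the required cover. -/

namespace SimpleGraph

/-! ### Obstructions from odd circuits with an odd ear -/

variable {W : Type*}

/-- `m` restricts to a perfect matching of `U` on `Z`. -/
def PerfectOn (U : SimpleGraph W) (Z : Finset W) (m : W → W) : Prop :=
  ∀ z ∈ Z, m z ∈ Z ∧ m (m z) = z ∧ U.Adj z (m z)

/-- `m` restricts to a matching of `U` on `Y` which misses `r` only. -/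
def NearPerfectOn (U : SimpleGraph W) (Y : Finset W) (r : W) (m : W → W) : Prop :=
  r ∈ Y ∧ m r = r ∧ ∀ y ∈ Y, y ≠ r → m y ∈ Y ∧ m (m y) = y ∧ U.Adj y (m y)

/-- Three near-perfect matchings on a common vertex set which, together with one more edge `ur`,
carry a weight excluded by h-perfection of the line graph. -/
def Obstructed (U : SimpleGraph W) : Prop :=
  ∃ (X : Finset W) (m₁ m₂ m₃ : W → W) (u r : W), U.NearPerfectOn X r m₁ ∧
    U.NearPerfectOn X r m₂ ∧ U.NearPerfectOn X u m₃ ∧ U.Adj u r ∧ m₁ u ≠ m₂ u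

theorem NearPerfectOn.piecewise [DecidableEq W] {U : SimpleGraph W} {Y Z : Finset W} {r : W}
    {m h : W → W}
    (hm : U.NearPerfectOn Y r m) (hh : U.PerfectOn Z h) (hd : Disjoint Y Z) :
    U.NearPerfectOn (Y ∪ Z) r (fun x => if x ∈ Z then h x else m x) := by
  have hY : ∀ y ∈ Y, y ∉ Z := fun y hy => Finset.disjoint_left.1 hd hy
  refine ⟨Finset.mem_union_left _ hm.1, by simp [hY r hm.1, hm.2.1], fun y hy hyr => ?_⟩
  by_cases hyZ : y ∈ Z
  · obtain ⟨h1, h2, h3⟩ := hh y hyZ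
    simp [hyZ, h1, h2, h3]
  · have hyY : y ∈ Y := by simpa [hyZ] using hy
    obtain ⟨h1, h2, h3⟩ := hm.2.2 y hyY hyr
    simp [hyZ, h1, h2, h3, hY _ h1]

/-- The vertices `p 0, …, p (2 * L)` form a circuit of `U`, and `p (2 * L + 1) = p 0`. -/
structure OddCircuit (U : SimpleGraph W) (L : ℕ) (p : ℕ → W) : Prop where
  closed : p (2 * L + 1) = p 0
  inj : ∀ i j, i < 2 * L + 1 → j < 2 * L + 1 → p i = p j → i = j
  adj : ∀ i, i < 2 * L + 1 → U.Adj (p i) (p (i + 1))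

namespace OddCircuit

variable {U : SimpleGraph W} {L : ℕ} {p : ℕ → W}

theorem reverse (hp : U.OddCircuit L p) : U.OddCircuit L (fun i => p (2 * L + 1 - i)) where
  closed := by simp [hp.closed]
  inj i j hi hj h := by
    have key : ∀ i, i < 2 * L + 1 → p (2 * L + 1 - i) = p (if i = 0 then 0 else 2 * L + 1 - i) := by
      intro i _
      split_ifs with h
      · simp [h, hp.closed]
      · rfl
    simp only [key i hi, key j hj] at h
    have := hp.inj _ _ (by split_ifs <;> omega) (by split_ifs <;> omega) h
    split_ifs at this <;> omega
  adj i hi := by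
    have := hp.adj (2 * L + 1 - (i + 1)) (by omega)
    rw [show 2 * L + 1 - (i + 1) + 1 = 2 * L + 1 - i by omega] at this
    exact this.symm

theorem shift (hp : U.OddCircuit L p) {a : ℕ} (ha : a < 2 * L + 1) :
    U.OddCircuit L (fun i => if i + a < 2 * L + 1 then p (i + a) else p (i + a - (2 * L + 1))) where
  closed := by
    rw [if_neg (by omega), if_pos (by omega)]
    congr 1
    omega
  inj i j hi hj h := by
    have key : ∀ i, (if i + a < 2 * L + 1 then p (i + a) else p (i + a - (2 * L + 1)))
        = p (if i + a < 2 * L + 1 then i + a else i + a - (2 * L + 1)) := by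
      intro i
      split_ifs <;> rfl
    simp only [key] at h
    have := hp.inj _ _ (by split_ifs <;> omega) (by split_ifs <;> omega) h
    split_ifs at this <;> omega
  adj i hi := by
    by_cases h : i + a + 1 < 2 * L + 1
    · rw [if_pos (by omega), if_pos (by omega), show i + 1 + a = i + a + 1 by omega]
      exact hp.adj _ (by omega)
    · by_cases h' : i + a < 2 * L + 1
      · rw [if_pos h', if_neg (by omega), show i + 1 + a - (2 * L + 1) = 0 by omega, ← hp.closed,
          show 2 * L + 1 = i + a + 1 by omega]
        exact hp.adj _ (by omega)
      · rw [if_neg h', if_neg (by omega),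
          show i + 1 + a - (2 * L + 1) = i + a - (2 * L + 1) + 1 by omega]
        exact hp.adj _ (by omega)

theorem exists_index (hp : U.OddCircuit L p) : ∃ idx : W → ℕ, ∀ i < 2 * L + 1, idx (p i) = i := by
  classical
  refine ⟨fun x => if h : ∃ i < 2 * L + 1, p i = x then h.choose else 0, fun i hi => ?_⟩
  have h : ∃ j < 2 * L + 1, p j = p i := ⟨i, hi, rfl⟩
  simp only [h, dif_pos]
  exact hp.inj _ _ h.choose_spec.1 hi h.choose_spec.2

/-- The alternatives in `hg` say that `i` and `g i` are consecutive on the circuit, the last two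
covering the closing edge. Matchings along the circuit thus reduce to arithmetic of indices. -/
theorem nearPerfectOn [DecidableEq W] (hp : U.OddCircuit L p) {idx : W → ℕ}
    (hidx : ∀ i < 2 * L + 1, idx (p i) = i) (I : Finset ℕ) (hI : ∀ i ∈ I, i < 2 * L + 1) {r : ℕ}
    (hr : r ∈ I) (g : ℕ → ℕ) (hgr : g r = r)
    (hg : ∀ i ∈ I, i ≠ r → g i ∈ I ∧ g (g i) = i ∧
      (g i = i + 1 ∨ i = g i + 1 ∨ (i = 0 ∧ g i = 2 * L) ∨ (g i = 0 ∧ i = 2 * L))) :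
    U.NearPerfectOn (I.image p) (p r) (fun x => p (g (idx x))) := by
  refine ⟨Finset.mem_image_of_mem _ hr, by simp [hidx r (hI r hr), hgr], fun y hy hyr => ?_⟩
  obtain ⟨i, hi, rfl⟩ := Finset.mem_image.1 hy
  have hir : i ≠ r := fun h => hyr (h ▸ rfl)
  obtain ⟨h1, h2, h3⟩ := hg i hi hir
  have e1 := hidx i (hI i hi)
  have e2 := hidx _ (hI _ h1)
  refine ⟨?_, by simp only [e1, e2, h2], ?_⟩
  · simp only [e1]
    exact Finset.mem_image_of_mem _ h1
  · simp only [e1]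
    rcases h3 with h3 | h3 | ⟨h3, h4⟩ | ⟨h3, h4⟩
    · rw [h3]; exact hp.adj i (hI i hi)
    · rw [h3]
      have := hp.adj (g i) (hI _ h1)
      rw [← h3] at this ⊢
      exact this.symm
    · rw [h4, h3, ← hp.closed]
      exact (hp.adj (2 * L) (by omega)).symm
    · rw [h3, h4, ← hp.closed]
      exact hp.adj (2 * L) (by omega)

/-- The obstruction has as `X` the circuit with the interior `Z` of the ear, `u = p 0` and `r = p
1`. The first matching uses `γ` on the ear and its ends; the other two use `δ` on `Z` and run along
the circuit, missing `p 1` and `p 0`. At `u` the first two lead to `γ (p 0)` and `p (2 * L)`. -/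
theorem obstructed_of_even_ear [DecidableEq W] (hp : U.OddCircuit L p) {γ δ : W → W}
    {Z : Finset W} {j : ℕ}
    (hj : j < 2 * L + 1) (hj0 : j ≠ 0) (hje : Even j) (hZ : ∀ i < 2 * L + 1, p i ∉ Z)
    (hδ : U.PerfectOn Z δ) (hγ : U.PerfectOn (insert (p 0) (insert (p j) Z)) γ)
    (hne : γ (p 0) ≠ p (2 * L)) : U.Obstructed := by
  obtain ⟨idx, hidx⟩ := hp.exists_index
  obtain ⟨e, rfl⟩ := hje
  set I := Finset.range (2 * L + 1)
  have hII : ∀ i, i ∈ I ↔ i < 2 * L + 1 := fun i => Finset.mem_range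
  -- Without the ends of the ear the circuit falls into two paths. The one between `p 0` and `p (e +
  -- e)` has an odd number of vertices and leaves over `p 1`; the other is matched perfectly.
  have h1 : U.NearPerfectOn (((I.erase 0).erase (e + e)).image p) (p 1) _ :=
    hp.nearPerfectOn hidx _ (by simp [hII]) (r := 1) (by simp [hII]; omega)
      (fun i => if i = 1 then 1 else if (i < e + e ↔ i % 2 = 0) then i + 1 else i - 1)
      (by simp) (by
        intro i hi hi1
        simp only [Finset.mem_erase, hII] at hi ⊢
        refine ⟨?_, ?_, ?_⟩ <;> (repeat' split) <;> omega)
  have h2 : U.NearPerfectOn (I.image p) (p 1) _ :=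
    hp.nearPerfectOn hidx _ (by simp [hII]) (r := 1) (by simp [hII]; omega)
      (fun i => if i = 1 then 1 else if i = 0 then 2 * L else if i = 2 * L then 0 else
        if i % 2 = 0 then i + 1 else i - 1)
      (by simp) (by
        intro i hi hi1
        simp only [hII] at hi ⊢
        refine ⟨?_, ?_, ?_⟩ <;> (repeat' split) <;> omega)
  have h3 : U.NearPerfectOn (I.image p) (p 0) _ :=
    hp.nearPerfectOn hidx _ (by simp [hII]) (r := 0) (by simp [hII])
      (fun i => if i = 0 then 0 else if i % 2 = 1 then i + 1 else i - 1)
      (by simp) (by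
        intro i hi hi1
        simp only [hII] at hi ⊢
        refine ⟨?_, ?_, ?_⟩ <;> (repeat' split) <;> omega)
  have hd : Disjoint (I.image p) Z := by
    rw [Finset.disjoint_left]
    intro x hx
    obtain ⟨i, hi, rfl⟩ := Finset.mem_image.1 hx
    exact hZ i ((hII i).1 hi)
  have hd' : Disjoint (((I.erase 0).erase (e + e)).image p)
      (insert (p 0) (insert (p (e + e)) Z)) := by
    rw [Finset.disjoint_left]
    intro x hx
    obtain ⟨i, hi, rfl⟩ := Finset.mem_image.1 hx
    simp only [Finset.mem_erase, hII] at hi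
    simp only [Finset.mem_insert, not_or]
    exact ⟨fun h => hi.2.1 (hp.inj _ _ hi.2.2 (by omega) h),
      fun h => hi.1 (hp.inj _ _ hi.2.2 (by omega) h), hZ i hi.2.2⟩
  have hX : ((I.erase 0).erase (e + e)).image p ∪ (insert (p 0) (insert (p (e + e)) Z))
      = I.image p ∪ Z := by
    have : I.image p = insert (p 0) (insert (p (e + e)) (((I.erase 0).erase (e + e)).image p)) := by
      rw [← Finset.image_insert, Finset.insert_erase (by simp [hII]; omega), ← Finset.image_insert,
        Finset.insert_erase (by simp [hII])]
    rw [this]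
    ext x
    simp only [Finset.mem_union, Finset.mem_insert]
    tauto
  have k1 := h1.piecewise hγ hd'
  rw [hX] at k1
  refine ⟨_, _, _, _, p 0, p 1, k1, h2.piecewise hδ hd, h3.piecewise hδ hd, hp.adj 0 (by omega), ?_⟩
  have e0 : idx (p 0) = 0 := hidx 0 (by omega)
  simp [hZ 0 (by omega), e0, hne]

/-- The circuit being odd, reversing it makes an odd `j` even. It also exchanges the neighbours `p
1` and `p (2 * L)` of `p 0`, so both must be excluded as `γ (p 0)`. -/
theorem obstructed_of_ear_zero [DecidableEq W] (hp : U.OddCircuit L p) {γ δ : W → W}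
    {Z : Finset W} {j : ℕ}
    (hj : j < 2 * L + 1) (hj0 : j ≠ 0) (hZ : ∀ i < 2 * L + 1, p i ∉ Z)
    (hδ : U.PerfectOn Z δ) (hγ : U.PerfectOn (insert (p 0) (insert (p j) Z)) γ)
    (hne : γ (p 0) ≠ p (2 * L)) (hne' : γ (p 0) ≠ p 1) : U.Obstructed := by
  rcases Nat.even_or_odd j with h | h
  · exact hp.obstructed_of_even_ear hj hj0 h hZ hδ hγ hne
  · refine hp.reverse.obstructed_of_even_ear (j := 2 * L + 1 - j) (γ := γ) (δ := δ) (Z := Z)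
      (by omega) (by omega) ?_ ?_ hδ ?_ ?_
    · rw [Nat.even_sub (by omega)]
      simp [h, Nat.not_even_iff_odd.2]
    · intro i hi
      rcases Nat.eq_zero_or_pos i with rfl | hi0
      · simpa [hp.closed] using hZ 0 (by omega)
      · exact hZ _ (by omega)
    · simpa [hp.closed, Nat.sub_sub_self hj.le] using hγ
    · simpa [hp.closed, show 2 * L + 1 - 2 * L = 1 by omega] using hne'

theorem obstructed_of_ear [DecidableEq W] (hp : U.OddCircuit L p) {γ δ : W → W} {Z : Finset W}
    {a b : ℕ}
    (ha : a < 2 * L + 1) (hb : b < 2 * L + 1) (hab : a ≠ b)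
    (hZ : ∀ i < 2 * L + 1, p i ∉ Z)
    (hδ : U.PerfectOn Z δ) (hγ : U.PerfectOn (insert (p a) (insert (p b) Z)) γ)
    (hne : ∀ i < 2 * L + 1, p (i + 1) = p a → γ (p a) ≠ p i) (hne' : γ (p a) ≠ p (a + 1)) :
    U.Obstructed := by
  refine (hp.shift ha).obstructed_of_ear_zero (γ := γ) (δ := δ) (Z := Z)
    (j := if a < b then b - a else b + (2 * L + 1) - a) (by split_ifs <;> omega)
    (by split_ifs <;> omega) ?_ hδ ?_ ?_ ?_
  · intro i hi
    split_ifs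
    · exact hZ _ (by omega)
    · exact hZ _ (by omega)
  · rw [if_pos (by omega), Nat.zero_add]
    by_cases h : a < b
    · rw [if_pos h, if_pos (by omega), Nat.sub_add_cancel h.le]
      exact hγ
    · rw [if_neg h, if_neg (by omega), show b + (2 * L + 1) - a + a - (2 * L + 1) = b by omega]
      exact hγ
  · rw [if_pos (by omega), Nat.zero_add]
    by_cases h : a = 0
    · rw [if_pos (by omega), h, Nat.add_zero]
      rw [h] at hne
      exact hne _ (by omega) hp.closed
    · rw [if_neg (by omega)]
      exact hne _ (by omega) (by congr 1; omega)
  · rw [if_pos (show 0 + a < 2 * L + 1 by omega), Nat.zero_add]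
    by_cases h : a + 1 < 2 * L + 1
    · rw [if_pos (by omega), Nat.add_comm 1 a]
      exact hne'
    · rw [if_neg (by omega), show 1 + a - (2 * L + 1) = 0 by omega, ← hp.closed,
        show 2 * L + 1 = a + 1 by omega]
      exact hne'

end OddCircuit

end SimpleGraph

/-! ### Alternating walks of two matchings -/

namespace SimpleGraph

variable {W : Type*}

/-- The sequence `x, a x, b (a x), a (b (a x)), …`. -/
def altSeq (a b : W → W) (x : W) : ℕ → W
  | 0 => x
  | n + 1 => if Even n then a (altSeq a b x n) else b (altSeq a b x n)

section altSeq

variable {a b : W → W} {x : W}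

theorem altSeq_fst_even {n : ℕ} (hn : Even n) : a (altSeq a b x n) = altSeq a b x (n + 1) := by
  simp [altSeq, hn]

theorem altSeq_fst_odd (ha : a.Involutive) {n : ℕ} (hn : Even n) :
    a (altSeq a b x (n + 1)) = altSeq a b x n := by
  simp [altSeq, hn, ha (altSeq a b x n)]

theorem altSeq_snd_odd {n : ℕ} (hn : Odd n) : b (altSeq a b x n) = altSeq a b x (n + 1) := by
  simp [altSeq, Nat.not_even_iff_odd.2 hn]

theorem altSeq_snd_even (hb : b.Involutive) {n : ℕ} (hn : Odd n) :
    b (altSeq a b x (n + 1)) = altSeq a b x n := by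
  simp [altSeq, Nat.not_even_iff_odd.2 hn, hb (altSeq a b x n)]

theorem fst_mem_range_altSeq (ha : a.Involutive) {y : W} (hy : y ∈ Set.range (altSeq a b x)) :
    a y ∈ Set.range (altSeq a b x) := by
  obtain ⟨n, rfl⟩ := hy
  rcases Nat.even_or_odd n with h | h
  · exact ⟨_, (altSeq_fst_even h).symm⟩
  · obtain ⟨n, rfl⟩ : ∃ m, n = m + 1 := ⟨n - 1, by have := h.pos; omega⟩
    exact ⟨n, (altSeq_fst_odd ha (by simpa [Nat.odd_add_one] using h)).symm⟩

theorem snd_mem_range_altSeq (hb : b.Involutive) (hx : b x = x) {y : W}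
    (hy : y ∈ Set.range (altSeq a b x)) : b y ∈ Set.range (altSeq a b x) := by
  obtain ⟨n, rfl⟩ := hy
  rcases Nat.even_or_odd n with h | h
  · rcases Nat.eq_zero_or_pos n with rfl | h0
    · exact ⟨0, hx.symm⟩
    · obtain ⟨n, rfl⟩ : ∃ m, n = m + 1 := ⟨n - 1, by omega⟩
      exact ⟨n, (altSeq_snd_even hb (by simpa [Nat.even_add_one] using h)).symm⟩
  · exact ⟨_, (altSeq_snd_odd h).symm⟩

theorem altSeq_add_eq {i j : ℕ} (hij : Even i ↔ Even j) (h : altSeq a b x i = altSeq a b x j) :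
    ∀ s, altSeq a b x (i + s) = altSeq a b x (j + s)
  | 0 => h
  | s + 1 => by
    have := altSeq_add_eq hij h s
    rw [← Nat.add_assoc, ← Nat.add_assoc, altSeq, altSeq, this]
    simp [Nat.even_add, hij]

/-- For opposite parities the step into position `i` and the step out of position `j` use the same
involution, so walking back from `i` agrees with walking on from `j`. -/
theorem altSeq_sub_eq (ha : a.Involutive) (hb : b.Involutive) {i j : ℕ} (hij : Even i ↔ ¬ Even j)
    (h : altSeq a b x i = altSeq a b x j) :
    ∀ s ≤ i, altSeq a b x (i - s) = altSeq a b x (j + s)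
  | 0, _ => h
  | s + 1, hs => by
    have ih := altSeq_sub_eq ha hb hij h s (by omega)
    obtain ⟨t, rfl⟩ : ∃ t, i = t + s + 1 := ⟨i - s - 1, by omega⟩
    rw [show t + s + 1 - s = t + 1 by omega] at ih
    rw [show t + s + 1 - (s + 1) = t by omega, ← Nat.add_assoc]
    rcases Nat.even_or_odd t with ht | ht
    · have he : Even (j + s) := by
        have ht' := ht
        rw [Nat.even_iff] at *
        simp only [Nat.even_iff] at hij
        omega
      rw [← altSeq_fst_odd ha ht, ih, altSeq_fst_even (a := a) he]
    · have he : Odd (j + s) := by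
        rw [Nat.odd_iff] at *
        simp only [Nat.even_iff] at hij
        omega
      rw [← altSeq_snd_even hb ht, ih, altSeq_snd_odd (b := b) he]

/-- A coincidence of equal parity propagates forward to the fresh value at `m`. One of opposite
parity is reflected: either it reaches `m`, or it runs back to the start, where `b x = x` turns it
into a coincidence of equal parity. -/
theorem altSeq_ne_of_lt (ha : a.Involutive) (hb : b.Involutive) (hx : b x = x) {m : ℕ}
    (hm : ∀ k < m, altSeq a b x k ≠ altSeq a b x m) {i j : ℕ} (hij : i < j) (hj : j ≤ m) :
    altSeq a b x i ≠ altSeq a b x j := by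
  have same : ∀ i j, i < j → j ≤ m → (Even i ↔ Even j) → altSeq a b x i ≠ altSeq a b x j := by
    intro i j hij hj hp h
    have := altSeq_add_eq hp h (m - j)
    rw [Nat.add_sub_cancel' hj] at this
    exact hm _ (by omega) this
  intro h
  by_cases hp : Even i ↔ Even j
  · exact same i j hij hj hp h
  · have hp' : Even i ↔ ¬ Even j := by tauto
    have hs := altSeq_sub_eq ha hb hp' h
    by_cases hc : m ≤ i + j
    · have := hs (m - j) (by omega)
      rw [Nat.add_sub_cancel' hj] at this
      exact hm _ (by omega) this
    · have h0 := hs i le_rfl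
      rw [Nat.sub_self] at h0
      have hodd : Odd (j + i) := by
        rw [← Nat.not_even_iff_odd, Nat.even_add]; tauto
      refine same 0 (j + i + 1) (by omega) (by omega) ?_ ?_
      · simp [hodd]
      · rw [← altSeq_snd_odd hodd, ← h0, altSeq, hx]

end altSeq

namespace OddCircuit

variable {U : SimpleGraph W} {L : ℕ} {p : ℕ → W}

/-- An alternating sequence which starts along an odd circuit and then leaves it does not meet the
rest of the circuit, unless there is an obstruction. -/
theorem altSeq_ne [DecidableEq W] (hp : U.OddCircuit L p) (hU : ¬ U.Obstructed) {γ δ : W → W}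
    (hγ : γ.Involutive) (hδ : δ.Involutive) (hγU : ∀ x, γ x ≠ x → U.Adj x (γ x))
    (hδU : ∀ x, δ x ≠ x → U.Adj x (δ x)) {s c : ℕ} (hc : Even c) (hsc : s + c < 2 * L + 1)
    (hs : δ (p s) = p s) (ht : ∀ i ≤ c, altSeq γ δ (p s) i = p (s + i))
    (hδp : ∀ i < 2 * L + 1, (i < s ∨ s + c < i) →
      ∃ j < 2 * L + 1, (j < s ∨ s + c < j) ∧ δ (p i) = p j)
    (hne : ∀ i < 2 * L + 1, p (i + 1) = p (s + c) → γ (p (s + c)) ≠ p i)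
    (hne' : γ (p (s + c)) ≠ p (s + c + 1)) (m : ℕ) {i : ℕ} (hi : i < 2 * L + 1)
    (hi' : i < s ∨ s + c < i) : altSeq γ δ (p s) m ≠ p i := by
  classical
  intro h
  set t := altSeq γ δ (p s) with htdef
  have hex : ∃ m, ∃ i < 2 * L + 1, (i < s ∨ s + c < i) ∧ t m = p i := ⟨m, i, hi, hi', h⟩
  clear h hi hi' i m
  obtain ⟨b, hb, hb', htm⟩ := Nat.find_spec hex
  have hmin := fun k (hk : k < Nat.find hex) => Nat.find_min hex hk
  set m := Nat.find hex with hmdef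
  have hcm : c < m := by
    by_contra hcon
    rw [ht m (by omega)] at htm
    have := hp.inj _ _ (by omega) hb htm
    omega
  have hm : ∀ k < m, t k ≠ t m := fun k hk hkm => hmin k hk ⟨b, hb, hb', hkm.trans htm⟩
  have hinj : ∀ i j, i < j → j ≤ m → t i ≠ t j := fun i j h1 h2 =>
    altSeq_ne_of_lt hγ hδ hs hm h1 h2
  -- The first hit is reached by `γ`: as `δ` preserves the rest of the circuit, a hit by `δ` would
  -- have a predecessor there.
  have hmo : Odd m := by
    rw [← Nat.not_even_iff_odd]
    intro hme
    obtain ⟨q, hq⟩ : ∃ q, m = q + 1 := ⟨m - 1, by omega⟩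
    obtain ⟨j, hj, hj', hδj⟩ := hδp b hb hb'
    refine hmin q (by omega) ⟨j, hj, hj', ?_⟩
    rw [← hδj, ← htm, hq, htdef, altSeq_snd_even hδ]
    rw [hq, Nat.even_add_one, Nat.not_even_iff_odd] at hme
    exact hme
  have hfst : ∀ k, c ≤ k → k ≤ m → ∃ k', c ≤ k' ∧ k' ≤ m ∧ k' ≠ k ∧ γ (t k) = t k' := by
    intro k h1 h2
    rcases Nat.even_or_odd k with hk | hk
    · have : k ≠ m := by rintro rfl; exact Nat.not_even_iff_odd.2 hmo hk
      exact ⟨k + 1, by omega, by omega, by omega, altSeq_fst_even hk⟩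
    · have : k ≠ c := by rintro rfl; exact Nat.not_even_iff_odd.2 hk hc
      obtain ⟨q, rfl⟩ : ∃ q, k = q + 1 := ⟨k - 1, by omega⟩
      exact ⟨q, by omega, by omega, by omega,
        altSeq_fst_odd hγ (by rwa [Nat.odd_add_one, Nat.not_odd_iff_even] at hk)⟩
  have hsnd : ∀ k, c < k → k < m → ∃ k', c < k' ∧ k' < m ∧ k' ≠ k ∧ δ (t k) = t k' := by
    intro k h1 h2
    rcases Nat.even_or_odd k with hk | hk
    · have : k ≠ c + 1 := by
        rintro rfl
        rw [Nat.even_add_one] at hk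
        exact hk hc
      obtain ⟨q, rfl⟩ : ∃ q, k = q + 1 := ⟨k - 1, by omega⟩
      exact ⟨q, by omega, by omega, by omega,
        altSeq_snd_even hδ (by rwa [Nat.even_add_one, Nat.not_even_iff_odd] at hk)⟩
    · have : k + 1 ≠ m := by
        intro h
        rw [← h, Nat.odd_add_one] at hmo
        exact hmo hk
      exact ⟨k + 1, by omega, by omega, by omega, altSeq_snd_odd hk⟩
  have hinj' : ∀ i j, i ≤ m → j ≤ m → i ≠ j → t i ≠ t j := by
    intro i j h1 h2 h3
    rcases lt_or_gt_of_ne h3 with h | h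
    · exact hinj i j h h2
    · exact (hinj j i h h1).symm
  have htc : t c = p (s + c) := ht c le_rfl
  have hset : insert (p (s + c)) (insert (p b) ((Finset.Ioo c m).image t))
      = (Finset.Icc c m).image t := by
    rw [← htc, ← htm, ← Finset.image_insert, ← Finset.image_insert]
    congr 1
    ext k
    simp only [Finset.mem_insert, Finset.mem_Ioo, Finset.mem_Icc]
    omega
  -- The walk from position `c` to position `m` is the ear: its interior is matched by `δ`, and
  -- together with its ends by `γ`, since `c` is even and `m` odd.
  refine hU (hp.obstructed_of_ear (γ := γ) (δ := δ) (Z := (Finset.Ioo c m).image t) (a := s + c)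
    (b := b) hsc hb (by omega) ?_ ?_ ?_ hne hne')
  · intro i hi himem
    obtain ⟨k, hk, hki⟩ := Finset.mem_image.1 himem
    rw [Finset.mem_Ioo] at hk
    by_cases hi' : i < s ∨ s + c < i
    · exact hmin k hk.2 ⟨i, hi, hi', hki⟩
    · refine hinj (i - s) k (by omega) hk.2.le ?_
      rw [ht _ (by omega), hki]
      congr 1
      omega
  · intro z hz
    obtain ⟨k, hk, rfl⟩ := Finset.mem_image.1 hz
    rw [Finset.mem_Ioo] at hk
    obtain ⟨k', h1, h2, h3, h4⟩ := hsnd k hk.1 hk.2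
    refine ⟨?_, hδ _, hδU _ ?_⟩
    · rw [h4]
      exact Finset.mem_image_of_mem _ (Finset.mem_Ioo.2 ⟨h1, h2⟩)
    · rw [h4]
      exact hinj' _ _ (by omega) (by omega) h3
  · rw [hset]
    intro z hz
    obtain ⟨k, hk, rfl⟩ := Finset.mem_image.1 hz
    rw [Finset.mem_Icc] at hk
    obtain ⟨k', h1, h2, h3, h4⟩ := hfst k hk.1 hk.2
    refine ⟨?_, hγ _, hγU _ ?_⟩
    · rw [h4]
      exact Finset.mem_image_of_mem _ (Finset.mem_Icc.2 ⟨h1, h2⟩)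
    · rw [h4]
      exact hinj' _ _ (by omega) (by omega) h3

end OddCircuit

end SimpleGraph

/-! ### Kempe changes and critical odd circuits -/

namespace SimpleGraph

variable {W ι : Type*}

theorem involutive_update [DecidableEq ι] {f : ι → W → W} (hf : ∀ i, (f i).Involutive) {i : ι}
    {m : W → W}
    (hm : m.Involutive) : ∀ j, (Function.update f i m j).Involutive := by
  intro j
  by_cases h : j = i
  · subst h
    simpa using hm
  · simpa [h] using hf j

variable [Fintype ι] [DecidableEq W]

/-- The number of the matchings `f i` which contain the edge `xy`. -/
def edgeCount (f : ι → W → W) (x y : W) : ℕ :=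
  ∑ i, if f i x = y then 1 else 0

theorem edgeCount_update [DecidableEq ι] (f : ι → W → W) (i : ι) (m : W → W) (x y : W) :
    edgeCount (Function.update f i m) x y + (if f i x = y then 1 else 0)
      = edgeCount f x y + if m x = y then 1 else 0 := by
  rw [edgeCount, edgeCount, ← Finset.add_sum_erase _ _ (Finset.mem_univ i),
    ← Finset.add_sum_erase _ (fun j => if f j x = y then 1 else 0) (Finset.mem_univ i)]
  have : ∑ j ∈ Finset.univ.erase i, (if Function.update f i m j x = y then 1 else 0)
      = ∑ j ∈ Finset.univ.erase i, if f j x = y then 1 else 0 := by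
    refine Finset.sum_congr rfl fun j hj => ?_
    rw [Function.update_of_ne (Finset.ne_of_mem_erase hj)]
  rw [this, Function.update_self]
  omega

/-- Interchanging two matchings on a set of vertices which is closed under both. -/
theorem exists_kempe_swap [DecidableEq ι] {f : ι → W → W} (hf : ∀ i, (f i).Involutive) {α β : ι}
    (hαβ : α ≠ β)
    {T : Set W} (hα : ∀ x ∈ T, f α x ∈ T) (hβ : ∀ x ∈ T, f β x ∈ T) :
    ∃ f' : ι → W → W, (∀ i, (f' i).Involutive) ∧ edgeCount f' = edgeCount f ∧
      (∀ i, i ≠ α → i ≠ β → f' i = f i) ∧ (∀ x ∈ T, f' α x = f β x ∧ f' β x = f α x) ∧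
      ∀ x ∉ T, f' α x = f α x ∧ f' β x = f β x := by
  classical
  have inv : ∀ a b : W → W, a.Involutive → b.Involutive → (∀ x ∈ T, a x ∈ T) →
      (∀ x ∈ T, b x ∈ T) →
      Function.Involutive (fun x => if x ∈ T then b x else a x) := by
    intro a b ha hb haT hbT x
    by_cases hx : x ∈ T
    · simp [hx, hbT x hx, hb x]
    · have : a x ∉ T := fun h => hx (by simpa [ha x] using haT _ h)
      simp [hx, this, ha x]
  refine ⟨Function.update (Function.update f α (fun x => if x ∈ T then f β x else f α x)) β
    (fun x => if x ∈ T then f α x else f β x),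
    involutive_update (involutive_update hf (inv _ _ (hf α) (hf β) hα hβ))
      (inv _ _ (hf β) (hf α) hβ hα), ?_, ?_, ?_, ?_⟩
  · ext x y
    have h1 := edgeCount_update f α (fun x => if x ∈ T then f β x else f α x) x y
    have h2 := edgeCount_update (Function.update f α (fun x => if x ∈ T then f β x else f α x)) β
      (fun x => if x ∈ T then f α x else f β x) x y
    rw [Function.update_of_ne hαβ.symm] at h2
    by_cases hx : x ∈ T
    · simp only [hx, if_true] at h1 h2
      omega
    · simp only [hx, if_false] at h1 h2
      omega
  · intro i h1 h2
    rw [Function.update_of_ne h2, Function.update_of_ne h1]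
  · intro x hx
    simp [hαβ, hx]
  · intro x hx
    simp [hαβ, hx]

/-- A matching which misses both ends of the uncoloured edge takes it up. -/
theorem exists_of_missing [DecidableEq ι] {c : W → W → ℕ} {f : ι → W → W}
    (hf : ∀ i, (f i).Involutive) {u v : W}
    (huv : u ≠ v)
    (hc : ∀ x y, x ≠ y → c x y = edgeCount f x y + if s(x, y) = s(u, v) then 1 else 0) {γ : ι}
    (hu : f γ u = u) (hv : f γ v = v) :
    ∃ f' : ι → W → W, (∀ i, (f' i).Involutive) ∧ ∀ x y, x ≠ y → c x y = edgeCount f' x y := by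
  have hne : ∀ x, x ≠ u → x ≠ v → f γ x ≠ u ∧ f γ x ≠ v := by
    intro x h1 h2
    refine ⟨fun h => h1 ?_, fun h => h2 ?_⟩
    · rw [← hf γ x, h, hu]
    · rw [← hf γ x, h, hv]
  refine ⟨Function.update f γ (fun x => if x = u then v else if x = v then u else f γ x),
    involutive_update hf ?_, fun x y hxy => ?_⟩
  · intro x
    by_cases h1 : x = u
    · simp [h1, huv.symm]
    · by_cases h2 : x = v
      · simp [h2, huv.symm]
      · simp [h1, h2, hne x h1 h2, hf γ x]
  · have h := edgeCount_update f γ (fun x => if x = u then v else if x = v then u else f γ x) x y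
    rw [hc x y hxy]
    have : (if s(x, y) = s(u, v) then 1 else 0) + (if f γ x = y then 1 else 0)
        = if (if x = u then v else if x = v then u else f γ x) = y then 1 else 0 := by
      by_cases h1 : x = u
      · subst h1
        simp [hu, hxy, eq_comm]
      · by_cases h2 : x = v
        · subst h2
          simp [hv, hxy, huv.symm, eq_comm]
        · simp [h1, h2]
    omega

theorem adj_of_apply_ne {U : SimpleGraph W} {c : W → W → ℕ} {f : ι → W → W}
    (hU : ∀ x y, x ≠ y → c x y ≠ 0 → U.Adj x y) (hc : ∀ x y, x ≠ y → edgeCount f x y ≤ c x y)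
    (i : ι) (x : W) (hx : f i x ≠ x) : U.Adj x (f i x) := by
  refine hU _ _ hx.symm fun h0 => ?_
  have h1 := Finset.single_le_sum (f := fun j => if f j x = f i x then 1 else 0)
    (fun _ _ => Nat.zero_le _) (Finset.mem_univ i)
  have h2 := hc _ _ hx.symm
  rw [if_pos rfl] at h1
  rw [h0] at h2
  exact absurd (h1.trans h2) (by omega)

/-- All copies of edges but one are coloured by `f`, and the uncoloured edge `p 0 p 1` closes
an alternating path of the colours `α` and `β` to an odd circuit. -/
structure Critical (U : SimpleGraph W) (c : W → W → ℕ) (f : ι → W → W) (α β : ι) (L : ℕ)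
    (p : ℕ → W) : Prop where
  invol : ∀ i, (f i).Involutive
  ne : α ≠ β
  circuit : U.OddCircuit L p
  count : ∀ x y, x ≠ y → c x y = edgeCount f x y + if s(x, y) = s(p 0, p 1) then 1 else 0
  fst_zero : f α (p 0) = p 0
  fst_odd : ∀ i < 2 * L + 1, Odd i → f α (p i) = p (i + 1)
  snd_one : f β (p 1) = p 1
  snd_even : ∀ i < 2 * L + 1, i ≠ 0 → Even i → f β (p i) = p (i + 1)

namespace Critical

variable {U : SimpleGraph W} {c : W → W → ℕ} {f : ι → W → W} {α β : ι} {L : ℕ} {p : ℕ → W}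

theorem pos (h : U.Critical c f α β L p) : 0 < L := by
  rcases Nat.eq_zero_or_pos L with rfl | h0
  · have := h.circuit.adj 0 (by omega)
    have h2 := h.circuit.closed
    simp only [Nat.mul_zero, Nat.zero_add] at h2 this
    rw [h2] at this
    exact absurd rfl this.ne
  · exact h0

/-- Colour `α` moves from the edge `p 1 p 2` to `p 0 p 1`, which leaves `p 1 p 2` uncoloured. Now
`β` misses `p 1` and `α` misses `p 2`, so the two colours exchange their roles. -/
theorem rotate [DecidableEq ι] (h : U.Critical c f α β L p) :
    ∃ f', U.Critical c f' β α L
      (fun i => if i + 1 < 2 * L + 1 then p (i + 1) else p (i + 1 - (2 * L + 1))) ∧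
      ∀ i, i ≠ α → i ≠ β → f' i = f i := by
  have hL := h.pos
  have h01 : p 0 ≠ p 1 := (h.circuit.adj 0 (by omega)).ne
  have h12 : p 1 ≠ p 2 := (h.circuit.adj 1 (by omega)).ne
  have h02 : p 0 ≠ p 2 := fun e => by
    have := h.circuit.inj 0 2 (by omega) (by omega) e
    omega
  have e0 := h.fst_zero
  have e1 : f α (p 1) = p 2 := h.fst_odd 1 (by omega) odd_one
  have e2 : f α (p 2) = p 1 := by rw [← e1, h.invol]
  set m : W → W := fun x => if x = p 0 then p 1 else if x = p 1 then p 0 else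
    if x = p 2 then p 2 else f α x with hm
  have hne : ∀ x, x ≠ p 0 → x ≠ p 1 → x ≠ p 2 → f α x ≠ p 0 ∧ f α x ≠ p 1 ∧ f α x ≠ p 2 := by
    intro x h0 h1 h2
    refine ⟨fun h' => h0 ?_, fun h' => h2 ?_, fun h' => h1 ?_⟩
    · rw [← h.invol α x, h', e0]
    · rw [← h.invol α x, h', e1]
    · rw [← h.invol α x, h', e2]
  have hminv : m.Involutive := by
    intro x
    by_cases h0 : x = p 0
    · simp [hm, h0, h01.symm]
    by_cases h1 : x = p 1
    · simp [hm, h1, h01.symm]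
    by_cases h2 : x = p 2
    · simp [hm, h2, h02.symm, h12.symm]
    · simp [hm, h0, h1, h2, hne x h0 h1 h2, h.invol α x]
  refine ⟨Function.update f α m, ⟨involutive_update h.invol hminv, h.ne.symm,
    h.circuit.shift (by omega), ?_, ?_, ?_, ?_, ?_⟩, fun i h1 _ => Function.update_of_ne h1 _ _⟩
  · intro x y hxy
    have h3 := edgeCount_update f α m x y
    have h4 := h.count x y hxy
    rw [if_pos (show 0 + 1 < 2 * L + 1 by omega), if_pos (show 1 + 1 < 2 * L + 1 by omega)]
    have : (if m x = y then 1 else 0) + (if s(x, y) = s(p (0 + 1), p (1 + 1)) then 1 else 0)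
        = (if f α x = y then 1 else 0) + (if s(x, y) = s(p 0, p 1) then 1 else 0) := by
      simp only [hm, Nat.zero_add, Nat.reduceAdd]
      by_cases h0 : x = p 0
      · subst h0
        simp [e0, hxy, h01, h02, eq_comm]
      by_cases h1 : x = p 1
      · subst h1
        simp only [e1, h01.symm, h12, Sym2.eq_iff]
        simp [eq_comm, add_comm]
      by_cases h2 : x = p 2
      · subst h2
        simp [e2, hxy, h02, h12.symm, eq_comm]
      · simp [h0, h1, h2]
    omega
  · rw [if_pos (by omega), Function.update_of_ne h.ne.symm, Nat.zero_add, h.snd_one]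
  · intro i hi ho
    have hi' : i + 1 < 2 * L + 1 := by
      obtain ⟨q, rfl⟩ := ho
      omega
    rw [if_pos hi', Function.update_of_ne h.ne.symm, h.snd_even _ hi' (by omega) ho.add_one]
    split_ifs with h'
    · rfl
    · rw [show i + 1 + 1 - (2 * L + 1) = 0 by omega, show i + 1 + 1 = 2 * L + 1 by omega,
        h.circuit.closed]
  · rw [if_pos (by omega), Function.update_self]
    simp [hm, h02.symm, h12.symm]
  · intro i hi hi0 he
    rw [Function.update_self]
    by_cases h' : i + 1 < 2 * L + 1
    · have ho : Odd (i + 1) := he.add_one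
      have hi2 : i + 1 + 1 < 2 * L + 1 := by
        obtain ⟨q, rfl⟩ := he
        omega
      rw [if_pos h', if_pos (by omega), ← h.fst_odd _ h' ho]
      have k0 : p (i + 1) ≠ p 0 := fun e => by
        have := h.circuit.inj _ _ h' (by omega) e
        omega
      have k1 : p (i + 1) ≠ p 1 := fun e => by
        have := h.circuit.inj _ _ h' (by omega) e
        omega
      have k2 : p (i + 1) ≠ p 2 := fun e => by
        have := h.circuit.inj _ _ h' (by omega) e
        rw [this] at ho
        exact absurd ho (by decide)
      simp [hm, k0, k1, k2]
    · rw [if_neg h', if_neg (by omega), show i + 1 - (2 * L + 1) = 0 by omega,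
        show i + 1 + 1 - (2 * L + 1) = 1 by omega]
      simp [hm]

theorem rotate_to [DecidableEq ι] (h : U.Critical c f α β L p) : ∀ a < 2 * L + 1,
    ∃ f' α' β' p', U.Critical c f' α' β' L p' ∧
      (∀ i < 2 * L + 1, p' i = if i + a < 2 * L + 1 then p (i + a) else p (i + a - (2 * L + 1))) ∧
      ∀ i, i ≠ α → i ≠ β → i ≠ α' ∧ i ≠ β' ∧ f' i = f i
  | 0, _ => ⟨f, α, β, p, h, fun i hi => by simp [hi], fun i h1 h2 => ⟨h1, h2, rfl⟩⟩
  | a + 1, ha => by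
    obtain ⟨f', α', β', p', h1, h2, h3⟩ := h.rotate_to a (by omega)
    obtain ⟨f'', h4, h5⟩ := h1.rotate
    refine ⟨f'', β', α', _, h4, fun i hi => ?_, fun i hα hβ => ?_⟩
    · by_cases h' : i + 1 < 2 * L + 1
      · rw [if_pos h', h2 _ h', show i + 1 + a = i + (a + 1) by omega]
      · rw [if_neg h', h2 _ (by omega), if_pos (by omega), if_neg (by omega)]
        congr 1
        omega
    · obtain ⟨k1, k2, k3⟩ := h3 i hα hβ
      exact ⟨k2, k1, (h5 i k1 k2).trans k3⟩

/-- A third colour which is deficient on the circuit, at its first vertex and elsewhere, allows to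
colour the last edge. -/
theorem exists_coloring_of_deficient [DecidableEq ι] (h : U.Critical c f α β L p)
    (hU : ∀ x y, x ≠ y → c x y ≠ 0 → U.Adj x y) (hob : ¬ U.Obstructed) {γ : ι} (hγα : γ ≠ α)
    (hγβ : γ ≠ β) (h0 : ∀ i < 2 * L + 1, i ≠ 0 → f γ (p 0) ≠ p i) {a : ℕ} (ha : a < 2 * L + 1)
    (hao : Odd a) (hγa : f γ (p a) ≠ p (a + 1)) :
    ∃ f' : ι → W → W, (∀ i, (f' i).Involutive) ∧ ∀ x y, x ≠ y → c x y = edgeCount f' x y := by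
  classical
  have hex : ∃ a, a < 2 * L + 1 ∧ Odd a ∧ f γ (p a) ≠ p (a + 1) := ⟨a, ha, hao, hγa⟩
  clear ha hao hγa a
  -- With `a` least, the chain of `γ` and `β` from `p 1` follows the circuit exactly up to `p a`.
  obtain ⟨ha, hao, hγa⟩ := Nat.find_spec hex
  have hmin := fun k (hk : k < Nat.find hex) => Nat.find_min hex hk
  set a := Nat.find hex
  have hmin' : ∀ i < a, Odd i → f γ (p i) = p (i + 1) := by
    intro i hi ho
    by_contra hcon
    exact hmin i hi ⟨by omega, ho, hcon⟩
  have hL := h.pos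
  have hinj := h.circuit.inj
  have hle : ∀ x y, x ≠ y → edgeCount f x y ≤ c x y := fun x y hxy => by
    rw [h.count x y hxy]
    omega
  have hadj := adj_of_apply_ne hU hle
  -- The chain of `γ` and `α` from `p 0` avoids the rest of the circuit. Exchanging the colours on
  -- it makes `γ` miss `p 0` and changes `γ` nowhere else on the circuit.
  have hnear : ∀ i < 2 * L + 1, i ≠ 0 → ∀ m, altSeq (f γ) (f α) (p 0) m ≠ p i := by
    intro i hi hi0 m
    refine h.circuit.altSeq_ne hob (h.invol γ) (h.invol α) (hadj γ) (hadj α) (s := 0) (c := 0)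
      Even.zero (by omega) h.fst_zero (by simp [altSeq]) ?_ ?_ (h0 1 (by omega) one_ne_zero)
      m hi (by omega)
    · intro j hj hj0
      rcases Nat.even_or_odd j with hje | hjo
      · obtain ⟨q, rfl⟩ : ∃ q, j = q + 1 := ⟨j - 1, by omega⟩
        have hq : Odd q := by
          rwa [Nat.even_add_one, Nat.not_even_iff_odd] at hje
        refine ⟨q, by omega, by have := hq.pos; omega, ?_⟩
        rw [← h.fst_odd q (by omega) hq, h.invol]
      · have : j + 1 < 2 * L + 1 := by
          obtain ⟨q, rfl⟩ := hjo
          omega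
        exact ⟨j + 1, this, by omega, h.fst_odd j hj hjo⟩
    · intro j hj hjp
      rw [Nat.add_zero]
      refine h0 j hj ?_
      rintro rfl
      exact (h.circuit.adj 0 (by omega)).ne hjp.symm
  obtain ⟨f₁, hf₁, hc₁, hf₁o, hf₁T, hf₁T'⟩ := exists_kempe_swap h.invol hγα
    (T := Set.range (altSeq (f γ) (f α) (p 0)))
    (fun x hx => fst_mem_range_altSeq (h.invol γ) hx)
    (fun x hx => snd_mem_range_altSeq (h.invol α) h.fst_zero hx)
  have g0 : f₁ γ (p 0) = p 0 := (hf₁T _ ⟨0, rfl⟩).1.trans h.fst_zero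
  have gi : ∀ i < 2 * L + 1, i ≠ 0 → f₁ γ (p i) = f γ (p i) := fun i hi hi0 =>
    (hf₁T' _ (by rintro ⟨m, hm⟩; exact hnear i hi hi0 m hm)).1
  have gβ : f₁ β = f β := hf₁o β hγβ.symm h.ne.symm
  have hadj₁ := adj_of_apply_ne hU (hc₁ ▸ hle)
  obtain ⟨q, hq⟩ := hao
  have hβ1 : f₁ β (p 1) = p 1 := by rw [gβ, h.snd_one]
  -- This chain leaves the circuit at `p a` and cannot reach `p 0`, so exchanging its colours frees
  -- `γ` at `p 1` and keeps it free at `p 0`.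
  have hfar : ∀ m, altSeq (f₁ γ) (f₁ β) (p 1) m ≠ p 0 := by
    intro m
    refine h.circuit.altSeq_ne hob (hf₁ γ) (hf₁ β) (hadj₁ γ) (hadj₁ β) (s := 1) (c := 2 * q)
      (even_two_mul q) (by omega) hβ1 ?_ ?_ ?_ ?_ m (by omega) (by omega)
    · intro i
      induction i with
      | zero => simp [altSeq]
      | succ i ih =>
        intro hi
        rw [altSeq, ih (by omega)]
        split_ifs with hie
        · rw [gi _ (by omega) (by omega), hmin' _ (by omega) (by
            rw [Nat.add_comm]; exact hie.add_one)]
          rfl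
        · rw [gβ, h.snd_even _ (by omega) (by omega) (by
            rw [Nat.add_comm]; exact (Nat.not_even_iff_odd.1 hie).add_one)]
          rfl
    · intro i hi hi'
      rw [gβ]
      rcases Nat.eq_zero_or_pos i with rfl | hi0
      · refine ⟨2 * L, by omega, by omega, ?_⟩
        rw [← h.circuit.closed, ← h.snd_even (2 * L) (by omega) (by omega) (even_two_mul L),
          h.invol]
      · rcases Nat.even_or_odd i with hie | hio
        · have := h.snd_even i hi (by omega) hie
          by_cases hl : i + 1 < 2 * L + 1
          · exact ⟨i + 1, hl, by omega, this⟩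
          · refine ⟨0, by omega, by omega, ?_⟩
            rw [this, ← h.circuit.closed]
            congr 1
            omega
        · obtain ⟨r, rfl⟩ := hio
          refine ⟨2 * r, by omega, by omega, ?_⟩
          rw [← h.snd_even (2 * r) (by omega) (by omega) (even_two_mul r), h.invol]
    · intro i hi hip
      rw [show 1 + 2 * q = a by omega] at hip ⊢
      have hia : i + 1 = a := by
        by_cases hl : i + 1 < 2 * L + 1
        · exact hinj _ _ hl ha hip
        · rw [show i + 1 = 2 * L + 1 by omega, h.circuit.closed] at hip
          have := hinj _ _ (by omega) ha hip
          omega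
      -- The chain does not turn back to `p (a - 1)`: either this is `p 0`, missed by `γ`, or `γ`
      -- already matches it with `p (a - 2)`.
      intro hcon
      have h1 : f₁ γ (p i) = p a := by rw [← hcon, hf₁]
      rcases Nat.eq_zero_or_pos i with rfl | hi0
      · rw [g0] at h1
        have := hinj _ _ (by omega) ha h1
        omega
      · obtain ⟨r, rfl⟩ : ∃ r, i = r + 1 := ⟨i - 1, by omega⟩
        have h2 : f₁ γ (p r) = p (r + 1) := by
          rw [gi _ (by omega) (by omega), hmin' r (by omega) ⟨q - 1, by omega⟩]
        have h3 : p r = p a := by rw [← h1, ← h2, hf₁]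
        have := hinj _ _ (by omega) ha h3
        omega
    · rw [show 1 + 2 * q = a by omega, gi a ha (by omega)]
      exact hγa
  obtain ⟨f₂, hf₂, hc₂, -, hf₂T, hf₂T'⟩ := exists_kempe_swap hf₁ hγβ
    (T := Set.range (altSeq (f₁ γ) (f₁ β) (p 1)))
    (fun x hx => fst_mem_range_altSeq (hf₁ γ) hx)
    (fun x hx => snd_mem_range_altSeq (hf₁ β) hβ1 hx)
  refine exists_of_missing (γ := γ) hf₂ (h.circuit.adj 0 (by omega)).ne ?_ ?_ ?_
  · rw [hc₂, hc₁]
    exact h.count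
  · rw [(hf₂T' _ (by rintro ⟨m, hm⟩; exact hfar m hm)).1, g0]
  · exact (hf₂T (p 1) ⟨0, rfl⟩).1.trans hβ1

end Critical

end SimpleGraph

/-! ### The edge-colouring theorem -/

namespace SimpleGraph

variable {W ι : Type*} [Fintype ι] [DecidableEq W]

/-- If the chain of `α` and `β` from `v` avoids `u`, exchanging its colours makes `α` free at both
ends. Otherwise the chain and `uv` form the circuit. -/
theorem exists_coloring_or_critical [DecidableEq ι] {U : SimpleGraph W} {c : W → W → ℕ}
    {f : ι → W → W}
    (hf : ∀ i, (f i).Involutive) {u v : W} (huv : u ≠ v)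
    (hU : ∀ x y, x ≠ y → c x y ≠ 0 → U.Adj x y)
    (hc : ∀ x y, x ≠ y → c x y = edgeCount f x y + if s(x, y) = s(u, v) then 1 else 0)
    {α β : ι} (hα : f α u = u) (hβ : f β v = v) :
    (∃ f' : ι → W → W, (∀ i, (f' i).Involutive) ∧ ∀ x y, x ≠ y → c x y = edgeCount f' x y) ∨
      ∃ L p, U.Critical c f α β L p := by
  classical
  by_cases hαβ : α = β
  · subst hαβ
    exact Or.inl (exists_of_missing hf huv hc hα hβ)
  have hadj := adj_of_apply_ne hU (f := f) (fun x y hxy => by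
    rw [hc x y hxy]
    omega)
  by_cases hex : ∃ m, altSeq (f α) (f β) v m = u
  · right
    have htm := Nat.find_spec hex
    have hmin := fun k (hk : k < Nat.find hex) => Nat.find_min hex hk
    set m := Nat.find hex
    set t := altSeq (f α) (f β) v
    -- An odd `m` would mean arriving at `u` by `α`, which misses `u`. Hence the chain has even
    -- length and the circuit is odd.
    have hme : Even m := by
      rw [← Nat.not_odd_iff_even]
      intro hmo
      obtain ⟨q, hq⟩ : ∃ q, m = q + 1 := ⟨m - 1, by have := hmo.pos; omega⟩
      have hqe : Even q := by
        rwa [hq, Nat.odd_add_one, Nat.not_odd_iff_even] at hmo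
      have h1 : f α (t (q + 1)) = t q := altSeq_fst_odd (hf α) hqe
      rw [← hq, htm, hα] at h1
      exact hmin q (by omega) h1.symm
    obtain ⟨L, hL⟩ := hme
    have hinj : ∀ i j, i < j → j ≤ m → t i ≠ t j := fun i j h1 h2 =>
      altSeq_ne_of_lt (hf α) (hf β) hβ (fun k hk hkm => hmin k hk (hkm.trans htm)) h1 h2
    have hp : ∀ i, i ≠ 0 → (if i = 0 then u else t (i - 1)) = t (i - 1) := fun i hi => if_neg hi
    have h0 : ∀ i, (if i + 1 = 0 then u else t (i + 1 - 1)) = t i := fun i => rfl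
    have hodd : ∀ i, Odd i → f α (if i = 0 then u else t (i - 1))
        = if i + 1 = 0 then u else t (i + 1 - 1) := by
      rintro i ⟨q, rfl⟩
      rw [hp _ (by omega), h0, Nat.add_sub_cancel]
      exact altSeq_fst_even (even_two_mul q)
    have heven : ∀ i, i ≠ 0 → Even i → f β (if i = 0 then u else t (i - 1))
        = if i + 1 = 0 then u else t (i + 1 - 1) := by
      intro i hi hie
      obtain ⟨q, rfl⟩ : ∃ q, i = q + 1 := ⟨i - 1, by omega⟩
      rw [hp _ hi, h0, Nat.add_sub_cancel]
      exact altSeq_snd_odd (by rwa [Nat.even_add_one, Nat.not_even_iff_odd] at hie)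
    have hclosed : (if 2 * L + 1 = 0 then u else t (2 * L + 1 - 1)) = u := by
      rw [h0, ← htm]
      congr 1
      omega
    have hpinj : ∀ i j, i < j → j < 2 * L + 1 →
        (if i = 0 then u else t (i - 1)) ≠ if j = 0 then u else t (j - 1) := by
      intro i j hij hj
      rw [hp j (by omega)]
      split_ifs with hi
      · rw [← htm]
        exact (hinj _ _ (by omega) le_rfl).symm
      · exact hinj _ _ (by omega) (by omega)
    have hsucc : ∀ i < 2 * L + 1, i ≠ 0 →
        (if i + 1 = 0 then u else t (i + 1 - 1)) ≠ if i = 0 then u else t (i - 1) := by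
      intro i hi hi0
      rw [hp i hi0, h0]
      exact (hinj _ _ (by omega) (by omega)).symm
    refine ⟨L, fun i => if i = 0 then u else t (i - 1), hf, hαβ, ⟨?_, ?_, ?_⟩, ?_, ?_, ?_, ?_, ?_⟩
    · exact hclosed
    · intro i j hi hj h
      rcases lt_trichotomy i j with hij | hij | hij
      · exact absurd h (hpinj i j hij hj)
      · exact hij
      · exact absurd h.symm (hpinj j i hij hi)
    · intro i hi
      rcases Nat.eq_zero_or_pos i with rfl | hi0
      · refine hU u v huv ?_
        rw [hc u v huv, if_pos rfl]
        omega
      · have hne := hsucc i hi (by omega)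
        rcases Nat.even_or_odd i with hie | hio
        · have h1 := heven i (by omega) hie
          rw [← h1] at hne ⊢
          exact hadj _ _ hne
        · have h1 := hodd i hio
          rw [← h1] at hne ⊢
          exact hadj _ _ hne
    · exact hc
    · exact hα
    · exact fun i _ hio => hodd i hio
    · exact hβ
    · exact fun i _ hi0 hie => heven i hi0 hie
  · left
    obtain ⟨f₁, hf₁, hc₁, -, hT, hT'⟩ := exists_kempe_swap hf hαβ
      (T := Set.range (altSeq (f α) (f β) v)) (fun x hx => fst_mem_range_altSeq (hf α) hx)
      (fun x hx => snd_mem_range_altSeq (hf β) hβ hx)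
    refine exists_of_missing (γ := α) hf₁ huv (hc₁.symm ▸ hc) ?_ ?_
    · exact (hT' u hex).1.trans hα
    · exact (hT v ⟨0, rfl⟩).1.trans hβ

/-- If every colour left at most one circuit vertex unmatched inside the circuit, each would
contribute at least `2 * L` ordered pairs; with the uncoloured edge the odd-set bound would be
exceeded. -/
theorem Critical.exists_two_unmatched {U : SimpleGraph W} {c : W → W → ℕ} {f : ι → W → W}
    {α β : ι} {L : ℕ} {p : ℕ → W} (h : U.Critical c f α β L p)
    (hodd : ∀ (S : Finset W) (N : ℕ), S.card = 2 * N + 1 →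
      ∑ x ∈ S, ∑ y ∈ S, c x y ≤ 2 * (Fintype.card ι * N)) :
    ∃ γ, ∃ i < 2 * L + 1, ∃ j < 2 * L + 1, i ≠ j ∧
      (∀ l < 2 * L + 1, l ≠ i → f γ (p i) ≠ p l) ∧ ∀ l < 2 * L + 1, l ≠ j → f γ (p j) ≠ p l := by
  classical
  by_contra! hcon
  set R := Finset.range (2 * L + 1) with hR
  have hmem : ∀ i, i ∈ R ↔ i < 2 * L + 1 := fun i => Finset.mem_range
  have hinjOn : Set.InjOn p R := fun i hi j hj hij =>
    h.circuit.inj i j ((hmem i).1 hi) ((hmem j).1 hj) hij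
  have hL := h.pos
  have hS := hodd (R.image p) L (by rw [Finset.card_image_of_injOn hinjOn, hR, Finset.card_range])
  rw [Finset.sum_image hinjOn] at hS
  simp_rw [Finset.sum_image hinjOn] at hS
  have h1 : ∀ γ, 2 * L ≤ ∑ i ∈ R, ∑ j ∈ R, if i ≠ j ∧ f γ (p i) = p j then 1 else 0 := by
    intro γ
    set bad := R.filter (fun i => ∀ l < 2 * L + 1, l ≠ i → f γ (p i) ≠ p l) with hbad
    have hb1 : bad.card ≤ 1 := by
      rw [Finset.card_le_one]
      intro i hi j hj
      simp only [hbad, Finset.mem_filter, hmem] at hi hj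
      by_contra hij
      obtain ⟨l, hl1, hl2, hl3⟩ := hcon γ i hi.1 j hj.1 hij hi.2
      exact hj.2 l hl1 hl2 hl3
    have hcard : (R \ bad).card = 2 * L + 1 - bad.card := by
      rw [Finset.card_sdiff_of_subset (Finset.filter_subset _ _), hR, Finset.card_range]
    have hle : ∑ i ∈ R \ bad, 1 ≤ ∑ i ∈ R, ∑ j ∈ R, if i ≠ j ∧ f γ (p i) = p j then 1 else 0 := by
      refine (Finset.sum_le_sum fun i hi => ?_).trans
        (Finset.sum_le_sum_of_subset (Finset.sdiff_subset (t := bad)))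
      simp only [hbad, Finset.mem_sdiff, Finset.mem_filter, hmem] at hi
      have hi2 := hi.2
      push Not at hi2
      obtain ⟨l, hl, hli, hfl⟩ := hi2 hi.1
      refine le_trans ?_ (Finset.single_le_sum
        (f := fun j => if i ≠ j ∧ f γ (p i) = p j then 1 else 0) (fun _ _ => Nat.zero_le _)
        ((hmem l).2 hl))
      simp [hli.symm, hfl]
    rw [Finset.sum_const, smul_eq_mul, mul_one, hcard] at hle
    omega
  have h2 : 1 ≤ ∑ i ∈ R, ∑ j ∈ R, if i ≠ j ∧ s(p i, p j) = s(p 0, p 1) then 1 else 0 := by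
    refine le_trans ?_ (Finset.single_le_sum (f := fun i => ∑ j ∈ R,
      if i ≠ j ∧ s(p i, p j) = s(p 0, p 1) then 1 else 0) (fun _ _ => Nat.zero_le _)
      ((hmem 0).2 (by omega)))
    refine le_trans ?_ (Finset.single_le_sum (f := fun j =>
      if 0 ≠ j ∧ s(p 0, p j) = s(p 0, p 1) then 1 else 0) (fun _ _ => Nat.zero_le _)
      ((hmem 1).2 (by omega)))
    simp
  have h3 : ∑ i ∈ R, ∑ j ∈ R, ((∑ γ, if i ≠ j ∧ f γ (p i) = p j then 1 else 0)
      + if i ≠ j ∧ s(p i, p j) = s(p 0, p 1) then 1 else 0) ≤ ∑ i ∈ R, ∑ j ∈ R, c (p i) (p j) := by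
    refine Finset.sum_le_sum fun i hi => Finset.sum_le_sum fun j hj => ?_
    by_cases hij : i = j
    · simp [hij]
    · rw [h.count _ _ (fun e => hij (hinjOn hi hj e)), edgeCount]
      simp [hij]
  have h4 : ∑ i ∈ R, ∑ j ∈ R, ∑ γ, (if i ≠ j ∧ f γ (p i) = p j then 1 else 0)
      = ∑ γ, ∑ i ∈ R, ∑ j ∈ R, if i ≠ j ∧ f γ (p i) = p j then 1 else 0 := by
    exact (Finset.sum_congr rfl fun i _ => Finset.sum_comm).trans Finset.sum_comm
  simp_rw [Finset.sum_add_distrib] at h3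
  have h5 : ∑ γ : ι, 2 * L ≤ ∑ γ, ∑ i ∈ R, ∑ j ∈ R, if i ≠ j ∧ f γ (p i) = p j then 1 else 0 :=
    Finset.sum_le_sum fun γ _ => h1 γ
  rw [Finset.sum_const, Finset.card_univ, smul_eq_mul] at h5
  rw [h4] at h3
  have h6 : Fintype.card ι * (2 * L) = 2 * (Fintype.card ι * L) := by ring
  omega

/-- Each of `α` and `β` leaves only one circuit vertex unmatched, so the deficient colour is a third
one. It is unaffected by rotations, which bring one of its two unmatched vertices to position `0`.
-/
theorem Critical.exists_coloring [DecidableEq ι] {U : SimpleGraph W} {c : W → W → ℕ} {f : ι → W → W}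
    {α β : ι} {L : ℕ} {p : ℕ → W} (h : U.Critical c f α β L p)
    (hU : ∀ x y, x ≠ y → c x y ≠ 0 → U.Adj x y) (hob : ¬ U.Obstructed)
    (hodd : ∀ (S : Finset W) (N : ℕ), S.card = 2 * N + 1 →
      ∑ x ∈ S, ∑ y ∈ S, c x y ≤ 2 * (Fintype.card ι * N)) :
    ∃ f' : ι → W → W, (∀ i, (f' i).Involutive) ∧ ∀ x y, x ≠ y → c x y = edgeCount f' x y := by
  obtain ⟨γ, i, hi, j, hj, hij, hγi, hγj⟩ := h.exists_two_unmatched hodd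
  have hγα : γ ≠ α := by
    rintro rfl
    have key : ∀ i < 2 * L + 1, (∀ l < 2 * L + 1, l ≠ i → f γ (p i) ≠ p l) → i = 0 := by
      intro i hi hb
      by_contra hi0
      rcases Nat.even_or_odd i with ⟨q, rfl⟩ | ho
      · refine hb (q + q - 1) (by omega) (by omega) ?_
        have := h.fst_odd (q + q - 1) (by omega) ⟨q - 1, by omega⟩
        rw [Nat.sub_add_cancel (by omega)] at this
        rw [← this, h.invol]
      · have ho' := ho
        obtain ⟨q, hq⟩ := ho'
        exact hb (i + 1) (by omega) (by omega) (h.fst_odd i hi ho)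
    exact hij ((key i hi hγi).trans (key j hj hγj).symm)
  have hγβ : γ ≠ β := by
    rintro rfl
    have key : ∀ i < 2 * L + 1, (∀ l < 2 * L + 1, l ≠ i → f γ (p i) ≠ p l) → i = 1 := by
      intro i hi hb
      by_contra hi1
      have hL := h.pos
      rcases Nat.eq_zero_or_pos i with rfl | hi0
      · refine hb (2 * L) (by omega) (by omega) ?_
        rw [← h.circuit.closed, ← h.snd_even (2 * L) (by omega) (by omega) (even_two_mul L),
          h.invol]
      rcases Nat.even_or_odd i with he | ⟨q, rfl⟩
      · have := h.snd_even i hi (by omega) he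
        by_cases hl : i + 1 < 2 * L + 1
        · exact hb (i + 1) hl (by omega) this
        · refine hb 0 (by omega) (by omega) ?_
          rw [this, ← h.circuit.closed]
          congr 1
          omega
      · refine hb (2 * q) (by omega) (by omega) ?_
        rw [← h.snd_even (2 * q) (by omega) (by omega) (even_two_mul q), h.invol]
    exact hij ((key i hi hγi).trans (key j hj hγj).symm)
  obtain ⟨f', α', β', p', h', hp', hf'⟩ := h.rotate_to i hi
  obtain ⟨k1, k2, k3⟩ := hf' γ hγα hγβ
  have hp'' : ∀ l < 2 * L + 1, ∃ l' < 2 * L + 1, p' l = p l' := by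
    intro l hl
    rw [hp' l hl]
    split_ifs with hli
    · exact ⟨_, hli, rfl⟩
    · exact ⟨_, by omega, rfl⟩
  have h00 : p' 0 = p i := by
    rw [hp' 0 (by omega), if_pos (by omega), Nat.zero_add]
  obtain ⟨b, hb, hb0, hbj⟩ : ∃ b < 2 * L + 1, b ≠ 0 ∧ p' b = p j := by
    by_cases hlt : i < j
    · refine ⟨j - i, by omega, by omega, ?_⟩
      rw [hp' _ (by omega), if_pos (by omega), Nat.sub_add_cancel hlt.le]
    · refine ⟨j + (2 * L + 1) - i, by omega, by omega, ?_⟩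
      rw [hp' _ (by omega), if_neg (by omega)]
      congr 1
      omega
  have hbad : ∀ l < 2 * L + 1, l ≠ b → f γ (p' b) ≠ p' l := by
    intro l hl hlb
    obtain ⟨l', hl', e⟩ := hp'' l hl
    rw [hbj, e]
    refine hγj l' hl' ?_
    rintro rfl
    exact hlb (h'.circuit.inj _ _ hl hb (e.trans hbj.symm))
  have h0 : ∀ l < 2 * L + 1, l ≠ 0 → f' γ (p' 0) ≠ p' l := by
    intro l hl hl0
    obtain ⟨l', hl', e⟩ := hp'' l hl
    rw [k3, h00, e]
    refine hγi l' hl' ?_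
    rintro rfl
    exact hl0 (h'.circuit.inj _ _ hl (by omega) (e.trans h00.symm))
  -- The positions other than `0` are paired as `(a, a + 1)` with `a` odd; `a` is chosen so that its
  -- pair contains `b`.
  rcases Nat.even_or_odd b with hbe | hbo
  · have hbo : Odd (b - 1) := by
      obtain ⟨q, rfl⟩ := hbe
      exact ⟨q - 1, by omega⟩
    refine h'.exists_coloring_of_deficient hU hob k1 k2 h0 (a := b - 1) (by omega) hbo ?_
    intro e
    rw [Nat.sub_add_cancel (by omega), k3] at e
    refine hbad (b - 1) (by omega) (by omega) ?_
    rw [← e, ← k3, h'.invol]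
  · refine h'.exists_coloring_of_deficient hU hob k1 k2 h0 hb hbo ?_
    have hb1 : b + 1 < 2 * L + 1 := by
      obtain ⟨q, rfl⟩ := hbo
      omega
    rw [k3]
    exact hbad _ hb1 (by omega)

/-- If every colour occurred at `u`, the uncoloured copy of `uv` would push the degree above the
number of colours. -/
theorem exists_missing [Fintype W] {c : W → W → ℕ} {f : ι → W → W} {u v : W} (huv : u ≠ v)
    (hc : ∀ x y, x ≠ y → c x y = edgeCount f x y + if s(x, y) = s(u, v) then 1 else 0)
    (hdeg : ∑ y, c u y ≤ Fintype.card ι) : ∃ i, f i u = u := by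
  by_contra! hcon
  have h1 : ∑ y ∈ Finset.univ.erase u, edgeCount f u y = Fintype.card ι := by
    simp only [edgeCount]
    rw [Finset.sum_comm, Fintype.card_eq_sum_ones]
    refine Finset.sum_congr rfl fun i _ => ?_
    rw [Finset.sum_ite_eq, if_pos (by simp [hcon i])]
  have h2 : 1 ≤ ∑ y ∈ Finset.univ.erase u, if s(u, y) = s(u, v) then 1 else 0 := by
    refine le_trans ?_ (Finset.single_le_sum (f := fun y => if s(u, y) = s(u, v) then 1 else 0)
      (fun _ _ => Nat.zero_le _) (Finset.mem_erase.2 ⟨huv.symm, Finset.mem_univ v⟩))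
    simp
  have h3 : ∑ y ∈ Finset.univ.erase u, c u y
      = ∑ y ∈ Finset.univ.erase u, (edgeCount f u y + if s(u, y) = s(u, v) then 1 else 0) :=
    Finset.sum_congr rfl fun y hy => hc u y (Finset.ne_of_mem_erase hy).symm
  rw [Finset.sum_add_distrib] at h3
  have h4 : ∑ y ∈ Finset.univ.erase u, c u y ≤ ∑ y, c u y :=
    Finset.sum_le_sum_of_subset (Finset.erase_subset _ _)
  omega

/-- Edge colouring of a weighted graph without obstruction: the degree and the odd-set conditions
suffice. -/
theorem exists_edgeColoring [DecidableEq ι] [Fintype W] {U : SimpleGraph W} (hob : ¬ U.Obstructed)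
    (c : W → W → ℕ) (hsymm : ∀ x y, c x y = c y x) (hU : ∀ x y, x ≠ y → c x y ≠ 0 → U.Adj x y)
    (hdeg : ∀ x, ∑ y, c x y ≤ Fintype.card ι)
    (hodd : ∀ (S : Finset W) (N : ℕ), S.card = 2 * N + 1 →
      ∑ x ∈ S, ∑ y ∈ S, c x y ≤ 2 * (Fintype.card ι * N)) :
    ∃ f : ι → W → W, (∀ i, (f i).Involutive) ∧ ∀ x y, x ≠ y → c x y = edgeCount f x y := by
  induction hn : ∑ x, ∑ y, c x y using Nat.strong_induction_on generalizing c with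
  | _ n ih =>
    by_cases hex : ∃ u v, u ≠ v ∧ c u v ≠ 0
    · obtain ⟨u, v, huv, hcuv⟩ := hex
      set c' : W → W → ℕ := fun x y => c x y - if s(x, y) = s(u, v) then 1 else 0 with hc'
      have hle : ∀ x y, c' x y ≤ c x y := fun x y => Nat.sub_le _ _
      have hlt : ∑ x, ∑ y, c' x y < n := by
        rw [← hn]
        refine Finset.sum_lt_sum (fun x _ => Finset.sum_le_sum fun y _ => hle x y)
          ⟨u, Finset.mem_univ u, Finset.sum_lt_sum (fun y _ => hle u y) ⟨v, Finset.mem_univ v, ?_⟩⟩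
        simp only [hc', if_true]
        omega
      obtain ⟨f, hf, hcf⟩ := ih _ hlt c' (fun x y => by simp only [hc', hsymm x y, Sym2.eq_swap])
        (fun x y hxy h0 => hU x y hxy (by have := hle x y; omega))
        (fun x => (Finset.sum_le_sum fun y _ => hle x y).trans (hdeg x))
        (fun S N hS => (Finset.sum_le_sum fun x _ => Finset.sum_le_sum fun y _ => hle x y).trans
          (hodd S N hS)) rfl
      have hc : ∀ x y, x ≠ y → c x y = edgeCount f x y + if s(x, y) = s(u, v) then 1 else 0 := by
        intro x y hxy
        rw [← hcf x y hxy]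
        simp only [hc']
        split_ifs with he
        · have : c x y ≠ 0 := by
            rcases Sym2.eq_iff.1 he with ⟨rfl, rfl⟩ | ⟨rfl, rfl⟩
            · exact hcuv
            · rwa [hsymm]
          omega
        · omega
      obtain ⟨α, hα⟩ := exists_missing huv hc (hdeg u)
      obtain ⟨β, hβ⟩ := exists_missing huv.symm (fun x y hxy => by
        rw [hc x y hxy, Sym2.eq_swap (a := v)]) (hdeg v)
      rcases exists_coloring_or_critical hf huv hU hc hα hβ with h | ⟨L, p, h⟩
      · exact h
      · exact h.exists_coloring hU hob hodd
    · push Not at hex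
      refine ⟨fun _ => id, fun _ _ => rfl, fun x y hxy => ?_⟩
      rw [hex x y hxy, edgeCount]
      simp [hxy]

end SimpleGraph

/-! ### Rank inequalities for odd holes, cliques and the stable set polytope -/

namespace SimpleGraph

section OddHole

variable {V : Type*} {G : SimpleGraph V}

/-- A stable set of the circuit is disjoint from its translate by one. -/
theorem two_mul_card_indep_cycleGraph {n : ℕ} (S : Finset (Fin (n + 2)))
    (hS : ∀ i ∈ S, ∀ j ∈ S, ¬ (cycleGraph (n + 2)).Adj i j) : 2 * S.card ≤ n + 2 := by
  have hd : Disjoint S (S.map (addRightEmbedding 1)) := by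
    rw [Finset.disjoint_left]
    intro i hi hi'
    obtain ⟨j, hj, rfl⟩ := Finset.mem_map.1 hi'
    exact hS _ hi j hj (by simp [cycleGraph_adj, addRightEmbedding])
  have := Finset.card_le_univ (S ∪ S.map (addRightEmbedding 1))
  rw [Finset.card_union_of_disjoint hd, Finset.card_map, Fintype.card_fin] at this
  omega

/-- Around a triangle three differences `±1` would sum to `0`, which is impossible modulo `n + 2 ≥
4`. -/
theorem cycleGraph_no_triangle {n : ℕ} (hn : 2 ≤ n) {a b c : Fin (n + 2)}
    (hab : (cycleGraph (n + 2)).Adj a b) (hbc : (cycleGraph (n + 2)).Adj b c)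
    (hac : (cycleGraph (n + 2)).Adj a c) : False := by
  have h1 : (1 : Fin (n + 2)) ≠ 0 := by
    simp
  have h21 : (1 : Fin (n + 2)) + 1 ≠ 1 := by
    simp
  have h3 : (1 : Fin (n + 2)) + 1 + 1 ≠ 0 := by
    intro h
    have := congrArg Fin.val h
    simp only [Fin.val_add, Fin.val_one, Fin.val_zero] at this
    rw [Nat.mod_eq_of_lt (show 1 + 1 < n + 2 by omega), Nat.mod_eq_of_lt (by omega)] at this
    omega
  rw [cycleGraph_adj] at hab hbc hac
  have e1 : a - c = (a - b) + (b - c) := by abel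
  have e2 : c - a = (c - b) + (b - a) := by abel
  have e3 : a - b = -(b - a) := by abel
  have e4 : b - c = -(c - b) := by abel
  rcases hab with h | h <;> rcases hbc with h' | h' <;> rcases hac with h'' | h''
  · rw [e1, h, h'] at h''; exact h21 h''
  · apply h3
    calc (1 : Fin (n + 2)) + 1 + 1 = (a - b) + (b - c) + (c - a) := by rw [h, h', h'']
      _ = 0 := by abel
  · rw [e1, h, e4, h'] at h''; simp at h''
  · rw [e2, h', ← neg_sub a b, h] at h''; simp at h''
  · rw [e1, h', e3, h] at h''; simp at h''
  · rw [e2, h, ← neg_sub b c, h'] at h''; simp at h''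
  · apply h3
    calc (1 : Fin (n + 2)) + 1 + 1 = (b - a) + (c - b) + (a - c) := by rw [h, h', h'']
      _ = 0 := by abel
  · rw [e2, h, h'] at h''; exact h21 h''

theorem IsOddHole.card_inter_le [DecidableEq V] {C : Finset V} (hC : G.IsOddHole C) {S : Finset V}
    (hS : G.IsIndepSet (S : Set V)) : 2 * (S ∩ C).card + 1 ≤ C.card := by
  classical
  obtain ⟨hodd, h5, ⟨φ⟩⟩ := hC
  obtain ⟨n, hn⟩ : ∃ n, C.card = n + 2 := ⟨C.card - 2, by omega⟩
  rw [hn] at φ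
  have hle := two_mul_card_indep_cycleGraph
    ((Finset.univ.filter fun x : (C : Set V) => (x : V) ∈ S).map φ.toEquiv.toEmbedding) (by
      intro i hi j hj hadj
      obtain ⟨x, hx, rfl⟩ := Finset.mem_map.1 hi
      obtain ⟨y, hy, rfl⟩ := Finset.mem_map.1 hj
      have h := φ.map_adj_iff.1 hadj
      exact hS (Finset.mem_filter.1 hx).2 (Finset.mem_filter.1 hy).2 (G.ne_of_adj h) h)
  have hcard : (Finset.univ.filter fun x : (C : Set V) => (x : V) ∈ S).card = (S ∩ C).card := by
    refine Finset.card_bij (fun x _ => (x : V)) (fun x hx => ?_) (fun x _ y _ h => Subtype.ext h)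
      (fun v hv => ?_)
    · exact Finset.mem_inter.2 ⟨(Finset.mem_filter.1 hx).2, x.2⟩
    · rw [Finset.mem_inter] at hv
      exact ⟨⟨v, hv.2⟩, by simp [hv.1], rfl⟩
  rw [Finset.card_map, hcard] at hle
  obtain ⟨q, hq⟩ := hodd
  omega

theorem IsOddHole.no_triangle {C : Finset V} (hC : G.IsOddHole C) {a b c : V} (ha : a ∈ C)
    (hb : b ∈ C) (hc : c ∈ C) (hab : G.Adj a b) (hbc : G.Adj b c) (hac : G.Adj a c) : False := by
  obtain ⟨-, h5, ⟨φ⟩⟩ := hC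
  obtain ⟨n, hn⟩ : ∃ n, C.card = n + 2 := ⟨C.card - 2, by omega⟩
  rw [hn] at φ
  refine cycleGraph_no_triangle (n := n) (by omega) (a := φ ⟨a, ha⟩) (b := φ ⟨b, hb⟩)
    (c := φ ⟨c, hc⟩) (φ.map_adj_iff.2 hab) (φ.map_adj_iff.2 hbc) (φ.map_adj_iff.2 hac)

theorem IsClique.card_inter_le [DecidableEq V] {K : Finset V} (hK : G.IsClique (K : Set V))
    {S : Finset V} (hS : G.IsIndepSet (S : Set V)) : (S ∩ K).card ≤ 1 := by
  rw [Finset.card_le_one]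
  intro a ha b hb
  rw [Finset.mem_inter] at ha hb
  by_contra hab
  exact hS ha.1 hb.1 hab (hK ha.2 hb.2 hab)

end OddHole

section Polytope

variable {V : Type*} {G : SimpleGraph V}

theorem sum_le_of_mem_stableSetPolytope [DecidableEq V] {x : V → ℝ} (hx : x ∈ G.stableSetPolytope)
    (T : Finset V)
    {b : ℕ} (hT : ∀ S : Finset V, G.IsIndepSet (S : Set V) → (S ∩ T).card ≤ b) :
    ∑ v ∈ T, x v ≤ b := by
  classical
  have hsub : G.stableSetPolytope ⊆ {x | ∑ v ∈ T, x v ≤ b} := by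
    refine convexHull_min ?_ (convex_halfSpace_le ⟨fun x y => ?_, fun c x => ?_⟩ _)
    · rintro _ ⟨S, hS, rfl⟩
      have h1 := hT (T.filter (· ∈ S))
        (hS.mono fun v hv => by simpa using (Finset.mem_filter.1 hv).2)
      rw [Finset.inter_eq_left.2 (Finset.filter_subset _ _)] at h1
      simp only [Set.mem_ofPred_eq, Set.indicator_apply, Pi.one_apply, Finset.sum_boole]
      exact_mod_cast h1
    · simp [Finset.sum_add_distrib]
    · simp [Finset.mul_sum]
  exact hsub hx

theorem nonneg_of_mem_stableSetPolytope {x : V → ℝ} (hx : x ∈ G.stableSetPolytope) (v : V) :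
    0 ≤ x v := by
  have hsub : G.stableSetPolytope ⊆ {x | 0 ≤ x v} := by
    refine convexHull_min ?_ (convex_halfSpace_ge ⟨fun x y => rfl, fun c x => rfl⟩ _)
    rintro _ ⟨S, hS, rfl⟩
    exact Set.indicator_nonneg (f := (1 : V → ℝ)) (fun _ _ => zero_le_one) v
  exact hsub hx

/-- Weak duality: each stable set of the cover contributes at most `b` times its multiplicity to the
weight of `T`. -/
theorem sum_le_of_mem_fractionalCoverSizes [Fintype V] [DecidableEq V] {c : V → ℕ} {q : ℚ}
    (hq : q ∈ G.fractionalCoverSizes c) (T : Finset V) {b : ℕ}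
    (hT : ∀ S : Finset V, G.IsIndepSet (S : Set V) → (S ∩ T).card ≤ b) :
    (∑ v ∈ T, c v : ℚ) ≤ q * b := by
  classical
  obtain ⟨y, hy, hcy, rfl⟩ := hq
  have h1 : (∑ v ∈ T, c v : ℚ) ≤ ∑ v ∈ T, ∑ S ∈ G.stableSets, if v ∈ S then y S else 0 := by
    refine Finset.sum_le_sum fun v _ => ?_
    rw [← Finset.sum_filter]
    exact (hcy v).trans_eq (by congr)
  refine h1.trans ?_
  rw [Finset.sum_comm, Finset.sum_mul]
  refine Finset.sum_le_sum fun S hS => ?_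
  rw [← Finset.sum_filter, Finset.sum_const, nsmul_eq_mul, mul_comm, Finset.filter_mem_eq_inter,
    Finset.inter_comm]
  exact mul_le_mul_of_nonneg_left (by exact_mod_cast hT S (by simpa [stableSets] using hS))
    (hy S hS)

end Polytope

/-! ### Line graphs, and h-perfection excluding obstructions -/

/-- `ends v` are the ends of the edge `v`, if `G` is the line graph of a loopless multigraph. -/
structure IsEdgeEnds {V W : Type*} (G : SimpleGraph V) (ends : V → Sym2 W) : Prop where
  not_isDiag : ∀ v, ¬ (ends v).IsDiag
  adj_iff : ∀ v w, G.Adj v w ↔ v ≠ w ∧ ∃ x, x ∈ ends v ∧ x ∈ ends w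

/-- The ends are taken in the vertex set of `H` rather than in its ambient type, which may be
infinite. -/
theorem IsLineGraph.exists_isEdgeEnds {V : Type*} {G : SimpleGraph V} (hG : G.IsLineGraph) :
    ∃ (W : Type) (_ : Fintype W) (ends : V → Sym2 W), G.IsEdgeEnds ends := by
  obtain ⟨α, β, H, hl, hV, -, ⟨φ⟩⟩ := hG
  have hlink : ∀ e : H.edgeSet, ∃ x y : H.vertexSet, H.IsLink e.1 x.1 y.1 := by
    intro e
    obtain ⟨x, y, h⟩ := H.exists_isLink_of_mem_edgeSet e.2
    exact ⟨⟨x, h.left_mem⟩, ⟨y, h.right_mem⟩, h⟩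
  choose a b hab using hlink
  have hinc : ∀ (e : H.edgeSet) (x : H.vertexSet), x ∈ s(a e, b e) ↔ H.Inc e.1 x.1 := by
    intro e x
    rw [Sym2.mem_iff]
    constructor
    · rintro (rfl | rfl)
      · exact (hab e).inc_left
      · exact (hab e).inc_right
    · intro h
      exact (h.eq_or_eq_of_isLink (hab e)).imp Subtype.ext Subtype.ext
  refine ⟨H.vertexSet, hV.fintype, fun v => s(a (φ v), b (φ v)), fun v hv => ?_, fun v w => ?_⟩
  · have h := hab (φ v)
    rw [Sym2.mk_isDiag_iff] at hv
    rw [hv] at h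
    exact hl.not_isLoopAt _ _ h
  · rw [← φ.map_adj_iff]
    simp only [hinc]
    refine and_congr φ.injective.ne_iff ⟨?_, ?_⟩
    · rintro ⟨x, h1, h2⟩
      exact ⟨⟨x, h1.vertex_mem⟩, h1, h2⟩
    · rintro ⟨x, h1, h2⟩
      exact ⟨x, h1, h2⟩

namespace IsEdgeEnds

variable {V W : Type*} {G : SimpleGraph V} {ends : V → Sym2 W}

theorem eq_of_mem (h : G.IsEdgeEnds ends) {S : Finset V} (hS : G.IsIndepSet (S : Set V)) {v w : V}
    (hv : v ∈ S) (hw : w ∈ S) {x : W} (hxv : x ∈ ends v) (hxw : x ∈ ends w) : v = w := by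
  by_contra hvw
  exact hS hv hw hvw ((h.adj_iff v w).2 ⟨hvw, x, hxv, hxw⟩)

theorem card_filter_mem_ends [DecidableEq W] (h : G.IsEdgeEnds ends) {X : Finset W} {v : V}
    (hv : ∀ x ∈ ends v, x ∈ X) : (X.filter (· ∈ ends v)).card = 2 := by
  have hd := h.not_isDiag v
  generalize ends v = e at hv hd
  induction e with
  | _ a b =>
    rw [Sym2.mk_isDiag_iff] at hd
    rw [← Finset.card_pair hd]
    congr 1
    ext x
    simp only [Finset.mem_filter, Sym2.mem_iff, Finset.mem_insert, Finset.mem_singleton]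
    exact ⟨fun h => h.2, fun h => ⟨hv x (Sym2.mem_iff.2 h), h⟩⟩

theorem two_mul_card_le [DecidableEq V] [DecidableEq W] (h : G.IsEdgeEnds ends) {S : Finset V}
    (hS : G.IsIndepSet (S : Set V))
    {X : Finset W} (hX : ∀ v ∈ S, ∀ x ∈ ends v, x ∈ X) : 2 * S.card ≤ X.card := by
  have h1 : (S.biUnion fun v => X.filter (· ∈ ends v)).card = ∑ v ∈ S, 2 := by
    rw [Finset.card_biUnion]
    · exact Finset.sum_congr rfl fun v hv => h.card_filter_mem_ends (hX v hv)
    · intro v hv w hw hvw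
      rw [Function.onFun, Finset.disjoint_left]
      intro x hx hx'
      exact hvw (h.eq_of_mem hS hv hw (Finset.mem_filter.1 hx).2 (Finset.mem_filter.1 hx').2)
  have h2 : (S.biUnion fun v => X.filter (· ∈ ends v)).card ≤ X.card :=
    Finset.card_le_card (Finset.biUnion_subset.2 fun v _ => Finset.filter_subset _ _)
  rw [h1, Finset.sum_const, smul_eq_mul] at h2
  omega

/-- The matching of edges given by a near-perfect matching on vertices. -/
theorem exists_matching [DecidableEq V] [DecidableEq W] (h : G.IsEdgeEnds ends) {rep : Sym2 W → V}
    (hrep : ∀ e ∈ Set.range ends, ends (rep e) = e) {U : SimpleGraph W}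
    (hU : ∀ x y, U.Adj x y → s(x, y) ∈ Set.range ends) {X : Finset W} {r : W} {m : W → W}
    (hm : U.NearPerfectOn X r m) :
    ∃ M : Finset V, G.IsIndepSet (M : Set V) ∧ 2 * M.card + 1 = X.card ∧
      (∀ y ∈ X, y ≠ r → rep s(y, m y) ∈ M ∧ ends (rep s(y, m y)) = s(y, m y)) ∧
      ∀ v ∈ M, ∀ y ∈ ends v, y ∈ X ∧ y ≠ r ∧ v = rep s(y, m y) := by
  have hends : ∀ y ∈ X, y ≠ r → ends (rep s(y, m y)) = s(y, m y) := fun y hy hyr =>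
    hrep _ (hU _ _ (hm.2.2 y hy hyr).2.2)
  have hmr : ∀ y ∈ X, y ≠ r → m y ≠ r := by
    intro y hy hyr he
    have := (hm.2.2 y hy hyr).2.1
    rw [he, hm.2.1] at this
    exact hyr this.symm
  set M := (X.erase r).image fun y => rep s(y, m y) with hM
  have key : ∀ v ∈ M, ∀ y ∈ ends v, y ∈ X ∧ y ≠ r ∧ v = rep s(y, m y) := by
    intro v hv y hy
    obtain ⟨z, hz, rfl⟩ := Finset.mem_image.1 hv
    rw [Finset.mem_erase] at hz
    rw [hends z hz.2 hz.1, Sym2.mem_iff] at hy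
    obtain ⟨h1, h2, -⟩ := hm.2.2 z hz.2 hz.1
    rcases hy with rfl | rfl
    · exact ⟨hz.2, hz.1, rfl⟩
    · exact ⟨h1, hmr z hz.2 hz.1, by rw [h2, Sym2.eq_swap]⟩
  have hind : G.IsIndepSet (M : Set V) := by
    intro v hv w hw hvw hadj
    obtain ⟨-, x, hx, hx'⟩ := (h.adj_iff v w).1 hadj
    exact hvw ((key v hv x hx).2.2.trans (key w hw x hx').2.2.symm)
  refine ⟨M, hind, ?_, fun y hy hyr =>
    ⟨Finset.mem_image.2 ⟨y, Finset.mem_erase.2 ⟨hyr, hy⟩, rfl⟩, hends y hy hyr⟩, key⟩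
  have h1 : (M.biUnion fun v => (X.erase r).filter (· ∈ ends v)).card = ∑ v ∈ M, 2 := by
    rw [Finset.card_biUnion]
    · exact Finset.sum_congr rfl fun v hv => h.card_filter_mem_ends fun y hy =>
        Finset.mem_erase.2 ⟨(key v hv y hy).2.1, (key v hv y hy).1⟩
    · intro v hv w hw hvw
      rw [Function.onFun, Finset.disjoint_left]
      intro x hx hx'
      exact hvw (h.eq_of_mem hind hv hw (Finset.mem_filter.1 hx).2 (Finset.mem_filter.1 hx').2)
  have h2 : (M.biUnion fun v => (X.erase r).filter (· ∈ ends v)) = X.erase r := by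
    refine Finset.Subset.antisymm (Finset.biUnion_subset.2 fun v _ => Finset.filter_subset _ _) ?_
    intro y hy
    have hy' := Finset.mem_erase.1 hy
    refine Finset.mem_biUnion.2 ⟨rep s(y, m y), Finset.mem_image.2 ⟨y, hy, rfl⟩,
      Finset.mem_filter.2 ⟨hy, ?_⟩⟩
    rw [hends y hy'.2 hy'.1]
    exact Sym2.mem_mk_left _ _
  rw [h2, Finset.card_erase_of_mem hm.1, Finset.sum_const, smul_eq_mul] at h1
  have := Finset.card_pos.2 ⟨r, hm.1⟩
  omega

/-- The point `x`, one third of the sum of the three matchings and the edge `e₃ = ur`, meets every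
inequality of the h-perfect description, yet its total exceeds the size of a largest matching inside
`X`. -/
theorem not_obstructed [DecidableEq V] [DecidableEq W] (h : G.IsEdgeEnds ends) (hG : G.IsHPerfect)
    {U : SimpleGraph W}
    (hU : ∀ x y, U.Adj x y → s(x, y) ∈ Set.range ends) : ¬ U.Obstructed := by
  classical
  rintro ⟨X, m₁, m₂, m₃, u, r, hm₁, hm₂, hm₃, hur, hne⟩
  have hV : Nonempty V := ⟨(hU u r hur).choose⟩
  obtain ⟨rep, hrep⟩ : ∃ rep : Sym2 W → V, ∀ e ∈ Set.range ends, ends (rep e) = e :=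
    ⟨Function.invFun ends, fun e he => Function.invFun_eq he⟩
  obtain ⟨M₁, hi₁, hc₁, hr₁, hk₁⟩ := h.exists_matching hrep hU hm₁
  obtain ⟨M₂, hi₂, hc₂, hr₂, hk₂⟩ := h.exists_matching hrep hU hm₂
  obtain ⟨M₃, hi₃, hc₃, hr₃, hk₃⟩ := h.exists_matching hrep hU hm₃
  have huX : u ∈ X := hm₃.1
  have hrX : r ∈ X := hm₁.1
  set e₁ := rep s(u, m₁ u)
  set e₂ := rep s(u, m₂ u)
  set e₃ := rep s(u, r)
  obtain ⟨he₁M, he₁⟩ : e₁ ∈ M₁ ∧ ends e₁ = s(u, m₁ u) := hr₁ u huX hur.ne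
  obtain ⟨he₂M, he₂⟩ : e₂ ∈ M₂ ∧ ends e₂ = s(u, m₂ u) := hr₂ u huX hur.ne
  have he₃ : ends e₃ = s(u, r) := hrep _ (hU u r hur)
  have hm₁r : m₁ u ≠ r := fun e =>
    (hk₁ e₁ he₁M r (by rw [he₁, e]; exact Sym2.mem_mk_right _ _)).2.1 rfl
  have hm₂r : m₂ u ≠ r := fun e =>
    (hk₂ e₂ he₂M r (by rw [he₂, e]; exact Sym2.mem_mk_right _ _)).2.1 rfl
  have he₁₂ : e₁ ≠ e₂ := fun e => by
    rw [e, he₂, Sym2.congr_right] at he₁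
    exact hne he₁.symm
  have he₁₃ : e₁ ≠ e₃ := fun e => by
    rw [e, he₃, Sym2.congr_right] at he₁
    exact hm₁r he₁.symm
  have he₂₃ : e₂ ≠ e₃ := fun e => by
    rw [e, he₃, Sym2.congr_right] at he₂
    exact hm₂r he₂.symm
  have hu₁ : u ∈ ends e₁ := by rw [he₁]; exact Sym2.mem_mk_left _ _
  have hu₂ : u ∈ ends e₂ := by rw [he₂]; exact Sym2.mem_mk_left _ _
  have hu₃ : u ∈ ends e₃ := by rw [he₃]; exact Sym2.mem_mk_left _ _
  have hadj : ∀ {a b : V}, a ≠ b → u ∈ ends a → u ∈ ends b → G.Adj a b := fun hab ha hb =>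
    (h.adj_iff _ _).2 ⟨hab, u, ha, hb⟩
  -- `M` misses `r` and covers `u` by `e` only, so `e` may be replaced by `e₃`.
  have swap : ∀ (M : Finset V) (m : W → W) (e : V), G.IsIndepSet (M : Set V) →
      (∀ v ∈ M, ∀ y ∈ ends v, y ∈ X ∧ y ≠ r ∧ v = rep s(y, m y)) → e = rep s(u, m u) →
      G.IsIndepSet ((insert e₃ (M.erase e) : Finset V) : Set V) := by
    intro M m e hi hk he
    have hno : ∀ v ∈ M.erase e, ¬ G.Adj e₃ v := by
      intro v hv ha
      rw [Finset.mem_erase] at hv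
      obtain ⟨-, x, hx, hx'⟩ := (h.adj_iff _ _).1 ha
      obtain ⟨-, hxr, hxv⟩ := hk v hv.2 x hx'
      rw [he₃, Sym2.mem_iff] at hx
      rcases hx with rfl | rfl
      · exact hv.1 (hxv.trans he.symm)
      · exact hxr rfl
    rw [Finset.coe_insert]
    refine Set.Pairwise.insert (hi.mono (by simp)) fun v hv _ =>
      ⟨hno v hv, fun ha => hno v hv ha.symm⟩
  have hi₁' := swap M₁ m₁ e₁ hi₁ hk₁ rfl
  have hi₂' := swap M₂ m₂ e₂ hi₂ hk₂ rfl
  set n : Finset V → ℕ := fun K => (M₁ ∩ K).card + (M₂ ∩ K).card + (M₃ ∩ K).card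
    + if e₃ ∈ K then 1 else 0 with hn
  have hswap : ∀ (M : Finset V) (e : V) (K : Finset V), e ∉ K → e₃ ∉ M →
      (M ∩ K).card + (if e₃ ∈ K then 1 else 0) = ((insert e₃ (M.erase e)) ∩ K).card := by
    intro M e K heK he₃M
    have h1 : M.erase e ∩ K = M ∩ K := by
      ext v
      simp only [Finset.mem_inter, Finset.mem_erase]
      constructor
      · exact fun hv => ⟨hv.1.2, hv.2⟩
      · exact fun hv => ⟨⟨fun hve => heK (hve ▸ hv.2), hv.1⟩, hv.2⟩
    by_cases h3 : e₃ ∈ K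
    · rw [Finset.insert_inter_of_mem h3, h1, Finset.card_insert_of_notMem (by simp [he₃M]),
        if_pos h3]
    · rw [Finset.insert_inter_of_notMem h3, h1, if_neg h3, add_zero]
  have hr₃' : r ∈ ends e₃ := by rw [he₃]; exact Sym2.mem_mk_right _ _
  have he₃₁ : e₃ ∉ M₁ := fun hmem => (hk₁ e₃ hmem r hr₃').2.1 rfl
  have he₃₂ : e₃ ∉ M₂ := fun hmem => (hk₂ e₃ hmem r hr₃').2.1 rfl
  -- If `K` contains `e₃` but not, say, `e₁`, then `e₃` is absorbed into `M₁` in place of `e₁`, and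
  -- three stable sets account for all of `n K`.
  have hbound : ∀ (K : Finset V) (b : ℕ), (∀ S : Finset V, G.IsIndepSet (S : Set V) →
      (S ∩ K).card ≤ b) → ¬ (e₁ ∈ K ∧ e₂ ∈ K ∧ e₃ ∈ K) → n K ≤ 3 * b := by
    intro K b hb hmiss
    have h1 := hb _ hi₁
    have h2 := hb _ hi₂
    have h3 := hb _ hi₃
    simp only [hn]
    by_cases h4 : e₃ ∈ K
    · by_cases h5 : e₁ ∈ K
      · have h6 : e₂ ∉ K := fun h6 => hmiss ⟨h5, h6, h4⟩
        have := hswap M₂ e₂ K h6 he₃₂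
        have h7 := hb _ hi₂'
        omega
      · have := hswap M₁ e₁ K h5 he₃₁
        have h7 := hb _ hi₁'
        omega
    · rw [if_neg h4]
      omega
  set x : V → ℝ := fun v => ((if v ∈ M₁ then 1 else 0) + (if v ∈ M₂ then 1 else 0)
    + (if v ∈ M₃ then 1 else 0) + (if v = e₃ then 1 else 0)) / 3 with hx
  have hsum : ∀ K : Finset V, ∑ v ∈ K, x v = (n K : ℝ) / 3 := by
    intro K
    simp only [hx, hn]
    rw [← Finset.sum_div]
    simp only [Finset.sum_add_distrib, Finset.sum_ite_eq']
    simp only [Finset.sum_boole, Finset.filter_mem_eq_inter, Finset.inter_comm K]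
    push_cast
    rfl
  have hxmem : x ∈ G.stableSetPolytope := by
    rw [show G.stableSetPolytope = _ from hG]
    refine ⟨fun v => ?_, fun K hK => ?_, fun C hC => ?_⟩
    · simp only [hx]
      positivity
    · rw [hsum, div_le_one (by norm_num)]
      have hb := fun (S : Finset V) (hS : G.IsIndepSet (S : Set V)) => hK.card_inter_le hS
      suffices n K ≤ 3 by exact_mod_cast this
      by_cases hall : e₁ ∈ K ∧ e₂ ∈ K ∧ e₃ ∈ K
      · obtain ⟨k1, k2, k3⟩ := hall
        -- An edge of the clique `K` avoiding `u` would have to contain the three distinct vertices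
        -- `m₁ u`, `m₂ u` and `r`. So `K` is a star at `u`, and `M₃` misses `u`.
        have hM₃ : M₃ ∩ K = ∅ := by
          rw [Finset.eq_empty_iff_forall_notMem]
          intro v hv
          rw [Finset.mem_inter] at hv
          have huv : u ∉ ends v := fun hu => (hk₃ v hv.1 u hu).2.1 rfl
          have hmem : ∀ (e : V) (y : W), e ∈ K → ends e = s(u, y) → y ∈ ends v := by
            intro e y he hey
            have hev : e ≠ v := by
              rintro rfl
              exact huv (by rw [hey]; exact Sym2.mem_mk_left _ _)
            obtain ⟨-, z, hz, hz'⟩ := (h.adj_iff _ _).1 (hK he hv.2 hev)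
            rw [hey, Sym2.mem_iff] at hz
            rcases hz with rfl | rfl
            · exact absurd hz' huv
            · exact hz'
          have g1 := hmem e₁ _ k1 he₁
          have g2 := hmem e₂ _ k2 he₂
          have g3 := hmem e₃ _ k3 he₃
          have := (Sym2.mem_and_mem_iff hne).1 ⟨g1, g2⟩
          rw [this, Sym2.mem_iff] at g3
          rcases g3 with g3 | g3
          · exact hm₁r g3.symm
          · exact hm₂r g3.symm
        have h1 := hb _ hi₁
        have h2 := hb _ hi₂
        simp only [hn, hM₃, Finset.card_empty, if_pos k3]
        omega
      · exact hbound K 1 hb hall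
    · rw [hsum]
      obtain ⟨q, hq⟩ := hC.1
      have hb : ∀ S : Finset V, G.IsIndepSet (S : Set V) → (S ∩ C).card ≤ q := by
        intro S hS
        have := hC.card_inter_le hS
        omega
      have := hbound C q hb fun ⟨k1, k2, k3⟩ => hC.no_triangle k1 k2 k3 (hadj he₁₂ hu₁ hu₂)
        (hadj he₂₃ hu₂ hu₃) (hadj he₁₃ hu₁ hu₃)
      have h' : (n C : ℝ) ≤ 3 * q := by exact_mod_cast this
      rw [hq]
      push_cast
      linarith
  set T := insert e₃ (M₁ ∪ M₂ ∪ M₃) with hT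
  have hTX : ∀ v ∈ T, ∀ y ∈ ends v, y ∈ X := by
    intro v hv y hy
    simp only [hT, Finset.mem_insert, Finset.mem_union] at hv
    rcases hv with rfl | (hv | hv) | hv
    · rw [he₃, Sym2.mem_iff] at hy
      rcases hy with rfl | rfl
      · exact huX
      · exact hrX
    · exact (hk₁ v hv y hy).1
    · exact (hk₂ v hv y hy).1
    · exact (hk₃ v hv y hy).1
  have hle := sum_le_of_mem_stableSetPolytope hxmem T (b := M₁.card) (by
    intro S hS
    have := h.two_mul_card_le (S := S ∩ T) (X := X) (hS.mono (by simp))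
      (fun v hv => hTX v (Finset.mem_inter.1 hv).2)
    omega)
  have hnT : n T = 3 * M₁.card + 1 := by
    have g1 : M₁ ∩ T = M₁ := Finset.inter_eq_left.2 fun v hv => by simp [hT, hv]
    have g2 : M₂ ∩ T = M₂ := Finset.inter_eq_left.2 fun v hv => by simp [hT, hv]
    have g3 : M₃ ∩ T = M₃ := Finset.inter_eq_left.2 fun v hv => by simp [hT, hv]
    simp only [hn, g1, g2, g3, if_pos (show e₃ ∈ T by simp [hT])]
    omega
  rw [hsum, hnT] at hle
  push_cast at hle
  linarith

end IsEdgeEnds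

end SimpleGraph

/-! ### From edge colourings to stable sets: decomposition and round-up -/

namespace SimpleGraph

variable {V : Type*}

/-- Used to share out the colours on a pair of vertices among the parallel edges joining it. -/
theorem exists_disjoint_of_card_eq {ι : Type*} [DecidableEq ι] [DecidableEq V] (c : V → ℕ)
    (E : Finset V) : ∀ I : Finset ι, I.card = ∑ v ∈ E, c v → ∃ A : V → Finset ι,
      (∀ v ∈ E, A v ⊆ I ∧ (A v).card = c v) ∧ ∀ v ∈ E, ∀ w ∈ E, v ≠ w → Disjoint (A v) (A w) := by
  induction E using Finset.induction_on with
  | empty => exact fun I _ => ⟨fun _ => ∅, by simp, by simp⟩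
  | insert a E ha ih =>
    intro I hI
    rw [Finset.sum_insert ha] at hI
    obtain ⟨B, hB, hBc⟩ := Finset.exists_subset_card_eq (show c a ≤ I.card by omega)
    obtain ⟨A, hA, hd⟩ := ih (I \ B) (by rw [Finset.card_sdiff_of_subset hB]; omega)
    have hne : ∀ v ∈ E, v ≠ a := fun v hv e => ha (e ▸ hv)
    have hdB : ∀ v ∈ E, Disjoint B (A v) := fun v hv =>
      Finset.disjoint_of_subset_right (hA v hv).1 Finset.disjoint_sdiff
    refine ⟨Function.update A a B, fun v hv => ?_, fun v hv w hw hvw => ?_⟩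
    · rcases Finset.mem_insert.1 hv with rfl | hv
      · simp [hB, hBc]
      · rw [Function.update_of_ne (hne v hv)]
        exact ⟨(hA v hv).1.trans Finset.sdiff_subset, (hA v hv).2⟩
    · rcases Finset.mem_insert.1 hv with rfl | hv' <;> rcases Finset.mem_insert.1 hw with rfl | hw'
      · exact absurd rfl hvw
      · rw [Function.update_self, Function.update_of_ne (hne w hw')]
        exact hdB w hw'
      · rw [Function.update_self, Function.update_of_ne (hne v hv')]
        exact (hdB v hv').symm
      · rw [Function.update_of_ne (hne v hv'), Function.update_of_ne (hne w hw')]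
        exact hd v hv' w hw' hvw

namespace IsEdgeEnds

variable [Fintype V] {W : Type*} [DecidableEq W] {G : SimpleGraph V}
  {ends : V → Sym2 W}

/-- Matchings on vertices with prescribed edge counts yield stable sets of the line graph, the
matchings through a given pair of vertices being distributed among the parallel edges. -/
theorem exists_stable_of_edgeCount [DecidableEq V] (h : G.IsEdgeEnds ends) (c : V → ℕ) {k : ℕ}
    {f : Fin k → W → W} (hf : ∀ i, (f i).Involutive)
    (hcount : ∀ x y, x ≠ y → ∑ v with ends v = s(x, y), c v = edgeCount f x y) :
    ∃ S : Fin k → Finset V, (∀ i, G.IsIndepSet (S i : Set V)) ∧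
      ∀ v, c v = (Finset.univ.filter fun i => v ∈ S i).card := by
  classical
  have hA : ∀ e : Sym2 W, ¬ e.IsDiag → ∃ A : V → Finset (Fin k),
      (∀ v, ends v = e → (∀ i ∈ A v, ∀ x y, e = s(x, y) → f i x = y) ∧ (A v).card = c v) ∧
      ∀ v w, ends v = e → ends w = e → v ≠ w → Disjoint (A v) (A w) := by
    intro e he
    induction e with
    | _ a b =>
      rw [Sym2.mk_isDiag_iff] at he
      obtain ⟨A, hA, hd⟩ := exists_disjoint_of_card_eq c
        (Finset.univ.filter fun v => ends v = s(a, b))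
        (Finset.univ.filter fun i => f i a = b) (by
          rw [hcount a b he, edgeCount, Finset.sum_boole]
          simp)
      refine ⟨A, fun v hv => ⟨fun i hi x y hxy => ?_, (hA v (by simp [hv])).2⟩,
        fun v w hv hw => hd v (by simp [hv]) w (by simp [hw])⟩
      have hab : f i a = b := (Finset.mem_filter.1 ((hA v (by simp [hv])).1 hi)).2
      rcases Sym2.eq_iff.1 hxy with ⟨rfl, rfl⟩ | ⟨rfl, rfl⟩
      · exact hab
      · rw [← hab, hf i]
  choose! A hA hd using hA
  refine ⟨fun i => Finset.univ.filter fun v => i ∈ A (ends v) v, fun i v hv w hw hvw hadj => ?_,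
    fun v => ?_⟩
  · have hv : i ∈ A (ends v) v := by simpa using hv
    have hw : i ∈ A (ends w) w := by simpa using hw
    obtain ⟨-, x, ⟨y, hy⟩, ⟨z, hz⟩⟩ := (h.adj_iff v w).1 hadj
    have h1 := (hA _ (h.not_isDiag v) v rfl).1 i hv x y hy
    have h2 := (hA _ (h.not_isDiag w) w rfl).1 i hw x z hz
    have hvw' : ends w = ends v := by rw [hy, hz, ← h1, ← h2]
    rw [hvw'] at hw
    exact Finset.disjoint_left.1 (hd _ (h.not_isDiag v) v w rfl hvw' hvw) hv hw
  · rw [← (hA _ (h.not_isDiag v) v rfl).2]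
    congr 1
    ext i
    simp

theorem sum_edgeWeight_le [Fintype W] (ends : V → Sym2 W) (c : V → ℕ) (x : W) :
    ∑ y, ∑ v with ends v = s(x, y), c v ≤ ∑ v with x ∈ ends v, c v := by
  simp_rw [Finset.sum_filter]
  rw [Finset.sum_comm]
  refine Finset.sum_le_sum fun v _ => ?_
  split_ifs with hx
  · obtain ⟨z, hz⟩ := hx
    rw [Finset.sum_eq_single z]
    · split_ifs
      exact le_rfl
    · intro y _ hyz
      rw [if_neg]
      rw [hz, Sym2.congr_right]
      exact hyz.symm
    · simp
  · refine (Finset.sum_eq_zero fun y _ => if_neg fun hy => hx ?_).le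
    rw [hy]
    exact Sym2.mem_mk_left _ _

/-- The double sum runs over ordered pairs, so an edge inside `X` is counted once from each end. -/
theorem sum_sum_edgeWeight_le [Fintype W] (h : G.IsEdgeEnds ends) (c : V → ℕ) (X : Finset W) :
    ∑ x ∈ X, ∑ y ∈ X, ∑ v with ends v = s(x, y), c v
      ≤ 2 * ∑ v with ∀ x ∈ ends v, x ∈ X, c v := by
  have h1 : ∀ x ∈ X, ∑ y ∈ X, ∑ v with ends v = s(x, y), c v
      ≤ ∑ v with ∀ z ∈ ends v, z ∈ X, if x ∈ ends v then c v else 0 := by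
    intro x hx
    simp_rw [Finset.sum_filter]
    rw [Finset.sum_comm]
    refine Finset.sum_le_sum fun v _ => ?_
    by_cases hxv : x ∈ ends v
    · rw [if_pos hxv]
      obtain ⟨z, hz⟩ := hxv
      by_cases hzX : z ∈ X
      · rw [if_pos (by
          intro a ha
          rw [hz, Sym2.mem_iff] at ha
          rcases ha with rfl | rfl <;> assumption), Finset.sum_eq_single z]
        · split_ifs
          exact le_rfl
        · intro y _ hyz
          rw [if_neg]
          rw [hz, Sym2.congr_right]
          exact hyz.symm
        · exact fun hn => absurd hzX hn
      · refine (Finset.sum_eq_zero fun y hy => if_neg fun hyv => hzX ?_).le.trans (Nat.zero_le _)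
        rw [hz, Sym2.congr_right] at hyv
        rwa [hyv]
    · refine (Finset.sum_eq_zero fun y _ => if_neg fun hy => hxv ?_).le.trans (Nat.zero_le _)
      rw [hy]
      exact Sym2.mem_mk_left _ _
  refine (Finset.sum_le_sum h1).trans ?_
  rw [Finset.sum_comm, Finset.mul_sum]
  refine Finset.sum_le_sum fun v hv => ?_
  rw [← Finset.sum_filter, Finset.sum_const,
    h.card_filter_mem_ends (Finset.mem_filter.1 hv).2, smul_eq_mul]

/-- In an h-perfect line graph, an integer vector of `k • STAB` splits into `k` stable sets. -/
theorem exists_stable_decomposition [DecidableEq V] [Fintype W] (h : G.IsEdgeEnds ends)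
    (hG : G.IsHPerfect) (c : V → ℕ)
    (k : ℕ) {x : V → ℝ} (hx : x ∈ G.stableSetPolytope) (hcx : ∀ v, (c v : ℝ) = k * x v) :
    ∃ S : Fin k → Finset V, (∀ i, G.IsIndepSet (S i : Set V)) ∧
      ∀ v, c v = (Finset.univ.filter fun i => v ∈ S i).card := by
  have hb : ∀ (T : Finset V) (b : ℕ), (∀ S : Finset V, G.IsIndepSet (S : Set V) →
      (S ∩ T).card ≤ b) → ∑ v ∈ T, c v ≤ k * b := by
    intro T b hT
    have h1 := sum_le_of_mem_stableSetPolytope hx T hT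
    have h2 : (∑ v ∈ T, c v : ℝ) ≤ k * b := by
      simp_rw [hcx, ← Finset.mul_sum]
      exact mul_le_mul_of_nonneg_left h1 (Nat.cast_nonneg k)
    exact_mod_cast h2
  -- Parallel edges are merged into one weight per pair. The degree and odd-set conditions are `hb`
  -- for the edges at a vertex, with `b = 1`, and for the edges inside `X`, with `b = N`.
  obtain ⟨f, hf, hcf⟩ := exists_edgeColoring (ι := Fin k)
    (h.not_obstructed hG (U := fromEdgeSet (Set.range ends)) fun x y hxy =>
      ((fromEdgeSet_adj _).1 hxy).1)
    (fun x y => ∑ v with ends v = s(x, y), c v) (fun x y => by simp only [Sym2.eq_swap])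
    (fun x y hxy hne => by
      obtain ⟨v, hv, -⟩ := Finset.exists_ne_zero_of_sum_ne_zero hne
      exact (fromEdgeSet_adj _).2 ⟨⟨v, (Finset.mem_filter.1 hv).2⟩, hxy⟩)
    (fun x => by
      rw [Fintype.card_fin]
      refine (sum_edgeWeight_le ends c x).trans ((hb _ 1 fun S hS => ?_).trans (mul_one k).le)
      rw [Finset.card_le_one]
      intro a ha b hb
      simp only [Finset.mem_inter, Finset.mem_filter] at ha hb
      exact h.eq_of_mem hS ha.1 hb.1 ha.2.2 hb.2.2)
    (fun X N hX => by
      rw [Fintype.card_fin]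
      refine (h.sum_sum_edgeWeight_le c X).trans (Nat.mul_le_mul_left 2 (hb _ N fun S hS => ?_))
      have := h.two_mul_card_le (S := S ∩ Finset.univ.filter fun v => ∀ x ∈ ends v, x ∈ X) (X := X)
        (hS.mono (by simp)) (fun v hv => by simpa using (Finset.mem_inter.1 hv).2)
      omega)
  exact h.exists_stable_of_edgeCount c hf hcf

theorem integerDecompositionProperty [Fintype W] (h : G.IsEdgeEnds ends) (hG : G.IsHPerfect) :
    IntegerDecompositionProperty G.stableSetPolytope := by
  classical
  intro k _ x hx
  obtain ⟨s, hs, hsx⟩ := Set.mem_smul_set.1 hx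
  have hxs : ∀ v, (x v : ℝ) = k * s v := fun v => (congrFun hsx v).symm
  have hx0 : ∀ v, 0 ≤ x v := fun v => by
    have : (0 : ℝ) ≤ x v := by
      rw [hxs]
      exact mul_nonneg (Nat.cast_nonneg k) (nonneg_of_mem_stableSetPolytope hs v)
    exact_mod_cast this
  obtain ⟨S, hS, hcS⟩ := h.exists_stable_decomposition hG (fun v => (x v).toNat) k hs fun v => by
    rw [← hxs]
    exact_mod_cast congrArg (Int.cast (R := ℝ)) (Int.toNat_of_nonneg (hx0 v))
  refine ⟨fun i v => if v ∈ S i then 1 else 0, fun i => subset_convexHull ℝ _ ⟨S i, hS i, ?_⟩, ?_⟩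
  · ext v
    simp [Set.indicator_apply]
  · ext v
    rw [Finset.sum_apply, Finset.sum_boole, ← hcS v]
    exact (Int.toNat_of_nonneg (hx0 v)).symm

theorem integerRoundUpProperty [Fintype W] (h : G.IsEdgeEnds ends) (hG : G.IsHPerfect) :
    G.IntegerRoundUpProperty := by
  classical
  intro c
  have hne : ((fun q : ℚ => (q : ℝ)) '' G.fractionalCoverSizes c).Nonempty := by
    obtain ⟨k, hk⟩ := G.coverSizes_nonempty c
    exact ⟨_, _, cast_mem_fractionalCoverSizes hk, rfl⟩
  have hbdd : BddBelow ((fun q : ℚ => (q : ℝ)) '' G.fractionalCoverSizes c) := by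
    refine ⟨0, ?_⟩
    rintro _ ⟨q, hq, rfl⟩
    exact Rat.cast_nonneg.2 (nonneg_of_mem_fractionalCoverSizes hq)
  have h0 : 0 ≤ G.weightedFractionalChromaticNumber c := by
    refine le_csInf hne ?_
    rintro _ ⟨q, hq, rfl⟩
    exact Rat.cast_nonneg.2 (nonneg_of_mem_fractionalCoverSizes hq)
  obtain ⟨k, hk⟩ := Int.eq_ofNat_of_zero_le (Int.ceil_nonneg h0)
  have hχk : G.weightedFractionalChromaticNumber c ≤ k := by
    have := Int.le_ceil (G.weightedFractionalChromaticNumber c)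
    rw [hk] at this
    exact_mod_cast this
  have hb : ∀ (T : Finset V) (b : ℕ), (∀ S : Finset V, G.IsIndepSet (S : Set V) →
      (S ∩ T).card ≤ b) → (∑ v ∈ T, c v : ℝ) ≤ k * b := by
    intro T b hT
    have h1 := fun q (hq : q ∈ G.fractionalCoverSizes c) =>
      sum_le_of_mem_fractionalCoverSizes hq T hT
    -- For `b > 0` the quotient of the weight of `T` by `b` bounds the infimum from below; for `b =
    -- 0` any single fractional cover shows that the weight is zero.
    rcases Nat.eq_zero_or_pos b with rfl | hb0
    · obtain ⟨-, q, hq, -⟩ := hne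
      have := h1 q hq
      simp only [Nat.cast_zero, mul_zero] at this ⊢
      exact_mod_cast this
    · have hb0' : (0 : ℝ) < b := by exact_mod_cast hb0
      rw [← div_le_iff₀ hb0']
      refine le_trans (le_csInf hne ?_) hχk
      rintro _ ⟨q, hq, rfl⟩
      rw [div_le_iff₀ hb0']
      have := h1 q hq
      beta_reduce
      exact_mod_cast this
  -- For `k = 0` division by zero makes `c / k` the zero vector, and `c = k * (c / k)` still holds
  -- because `c` vanishes.
  have hc0 : k = 0 → ∀ v, c v = 0 := by
    rintro rfl v
    have := hb {v} 1 fun S _ => (Finset.card_le_card Finset.inter_subset_right).trans (by simp)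
    simp only [Finset.sum_singleton, Nat.cast_zero, zero_mul] at this
    exact_mod_cast le_antisymm this (Nat.cast_nonneg _)
  have hx : (fun v => (c v : ℝ) / k) ∈ G.stableSetPolytope := by
    have hT : ∀ (T : Finset V) (b : ℕ), (∀ S : Finset V, G.IsIndepSet (S : Set V) →
        (S ∩ T).card ≤ b) → ∑ v ∈ T, (c v : ℝ) / k ≤ b := by
      intro T b hT
      rw [← Finset.sum_div]
      exact div_le_of_le_mul₀ (Nat.cast_nonneg k) (Nat.cast_nonneg b)
        ((hb T b hT).trans (mul_comm _ _).le)
    rw [show G.stableSetPolytope = _ from hG]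
    refine ⟨fun v => by positivity, fun K hK => ?_, fun C hC => ?_⟩
    · exact_mod_cast hT K 1 fun S hS => hK.card_inter_le hS
    · obtain ⟨q, hq⟩ := hC.1
      have := hT C q fun S hS => by
        have := hC.card_inter_le hS
        omega
      rw [hq]
      push_cast
      linarith
  obtain ⟨S, hS, hcS⟩ := h.exists_stable_decomposition hG c k hx fun v => by
    rcases Nat.eq_zero_or_pos k with rfl | hk0
    · simp [hc0 rfl v]
    · field_simp
  refine le_antisymm ?_ ?_
  · rw [hk]
    have : G.weightedChromaticNumber c ≤ k := Nat.sInf_le (by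
      -- The multiplicity of `T` is the number of colours whose stable set is `T`.
      refine ⟨fun T => (Finset.univ.filter fun i => S i = T).card, fun v => ?_, ?_⟩
      · rw [hcS v]
        refine (Finset.card_eq_sum_card_fiberwise (f := S)
          (t := G.stableSets.filter fun T => v ∈ T) fun i hi => ?_).trans_le
          (Finset.sum_le_sum fun T _ => Finset.card_le_card
            (Finset.filter_subset_filter _ (Finset.filter_subset _ _)))
        simp only [Finset.coe_filter, Finset.mem_univ, true_and, Set.mem_ofPred_eq] at hi ⊢
        exact ⟨by simpa [stableSets] using hS i, hi⟩
      · rw [← Finset.card_eq_sum_card_fiberwise (f := S) (s := Finset.univ) fun i _ => by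
          simpa [stableSets] using hS i]
        simp)
    exact_mod_cast this
  · refine Int.ceil_le.2 (csInf_le hbdd ⟨_, cast_mem_fractionalCoverSizes
      (Nat.sInf_mem (G.coverSizes_nonempty c)), ?_⟩)
    simp [weightedChromaticNumber]

end IsEdgeEnds

end SimpleGraph

theorem mainTheorem1 {V : Type*} [Fintype V] (G : SimpleGraph V) (hline : G.IsLineGraph)
    (hperf : G.IsHPerfect) :
    G.IntegerRoundUpProperty ∧ IntegerDecompositionProperty G.stableSetPolytope := by
  classical
  obtain ⟨W, _, ends, h⟩ := hline.exists_isEdgeEnds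
  exact ⟨h.integerRoundUpProperty hperf, h.integerDecompositionProperty hperf⟩
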